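/- Let $n\ge 1$, $r_1,\dots,r_n>0$, $T^n=\prod_{i=1}^n[0,r_i]$ with periodic identification, and $\nu_k=(2\pi k_1/r_1,\dots,2\pi k_n/r_n)$ for $k\in\mathbb Z^n$. For a periodic distribution $h$ on $T^n$ let $\hat h_k=|T^n|^{-1}\langle h,e^{-i\nu_k\cdot x}\rangle$, and for $q\in\mathbb R$ let $H^q(T^n)$ be the space of periodic distributions $h$ with $\|h\|_{H^q(T^n)}^2=\sum_{k\in\mathbb Z^n}(1+\|k\|^2)^q|\hat h_k|^2<\infty$. Let $\delta>0$ and $\beta<n+4$. For $\beta<n+2$ put $$m(\nu)=c^{\delta,\beta}\int_{B_\delta(0)}\frac{\cos(\nu\cdot z)-1}{\|z\|^\beta}\,dz,\qquad c^{\delta,\beta}=\frac{2(n+2-\beta)\Gamma(\frac n2+1)}{\pi^{n/2}\delta^{n+2-\beta}},$$ and for $n+2\le\beta<n+4$ put $$m(\nu)=-\|\nu\|^2\,{}_2F_3\left(1,\tfrac{n+2-\beta}{2};2,\tfrac{n+2}{2},\tfrac{n+4-\beta}{2};-\tfrac14\|\nu\|^2\delta^2\right).$$ For a periodic distribution $J$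 let $L^{\delta,\beta}J=\sum_{k\in\mathbb Z^n} m(\nu_k)\hat J_k e^{i\nu_k\cdot x}$, the series converging in the sense of periodic distributions. For $t>0$ and $q\in\mathbb R$, $V$ is the Gateaux derivative in $H^q(T^n)$ of $U$ at $t$ if $U$ is $H^q(T^n)$-valued near $t$, $V\in H^q(T^n)$ and $\left\|\frac1h[U(t+h)-U(t)]-V\right\|_{H^q(T^n)}\to0$ as $h\to0$. Let $s\in\mathbb R$ and $f\in H^s(T^n)$. By a solution with time derivative in $H^q$ of $$\frac{dU}{dt}=L^{\delta,\beta}U(t)\quad(t>0),\qquad U(0)=f, \tag{$*$}$$ we mean a function $U:[0,\infty)\to H^s(T^n)$ with $U(0)=f$, with $U(t)\to f$ in the sense of distributions as $t\to0^+$, and such that at each $t>0$ the Gateaux derivative of $U$ in $H^q(T^n)$ exists and equals $L^{\delta,\beta}U(t)$. Call $q\in\mathbb R$ admissible if $q=s$ or $\beta>n$. **Theorem.** There is a function $U:[0,\infty)\to H^s(T^n)$ such that: 1. $U$ is a solution of $(*)$ with time derivative in $H^q$ for every admissible $q$, and $U$ is continuous on $[0,\infty)$ in the norm of $H^s(T^n)$.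 2. For every $q\in\mathbb R$, every solution of $(*)$ with time derivative in $H^q$ coincides with $U$ on $[0,\infty)$. In particular, $(*)$ has exactly one solution for every admissible $q$. 3. For every integer $N\ge0$ and $t\ge0$ the series $$U^{(N)}(t)=\sum_{k\in\mathbb Z^n}\hat f_k\,m(\nu_k)^N e^{m(\nu_k)t}e^{i\nu_k\cdot x}$$ converges in the sense of periodic distributions to a periodic distribution, $U^{(0)}=U$, and for every $N\ge0$, $t>0$ and admissible $q$ the Gateaux derivative of $U^{(N)}$ at $t$ in $H^q(T^n)$ is $U^{(N+1)}(t)$; so $\frac{d^N}{dt^N}U(t)=U^{(N)}(t)$ for $t>0$. 4. $U\in C^\infty((0,\infty);H^p(T^n))$ in the sense of Gateaux differentiation, where $p=s$ if $\beta<n$; $p=p(t)=s+\frac{4nt}{\delta^2}(1-\epsilon)$ for any $\epsilon\in(0,1)$ if $\beta=n$; and $p$ is any real number (that is, $H^p$ may be replaced by $H^\infty(T^n)=\bigcap_{q\in\mathbb R}H^q(T^n)$) if $n<\beta<n+4$. When $p$ depends on $t$, this means that for each $t_0>0$ the function $U$ has, on a neighbourhood of $t_0$, Gateaux derivatives of all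 orders in $H^{p(t_0)}(T^n)$. -/

import Mathlib

open Filter Topology MeasureTheory
open scoped ContDiff ENNReal

noncomputable section

namespace NonlocalDiffusion

/-! ### Periodic test functions and periodic distributions -/

/-- The complex vector space `C^∞(T^n)`, `T^n = ∏ [0, r i]`: smooth functions on `ℝ^n` that have
period `r i` in the `i`-th coordinate. -/
def PeriodicTest {n : ℕ} (r : Fin n → ℝ) : Submodule ℂ (EuclideanSpace ℝ (Fin n) → ℂ) where
  carrier := {φ | ContDiff ℝ ∞ φ ∧ ∀ i x, φ (x + EuclideanSpace.single i (r i)) = φ x}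
  add_mem' := by
    rintro φ ψ ⟨h₁, h₂⟩ ⟨h₃, h₄⟩
    exact ⟨h₁.add h₃, fun i x => by simp [h₂ i x, h₄ i x]⟩
  zero_mem' := ⟨contDiff_const, fun _ _ => rfl⟩
  smul_mem' := by
    rintro c φ ⟨h₁, h₂⟩
    exact ⟨contDiff_const.smul h₁, fun i x => by simp [h₂ i x]⟩

/-- Periodic distributions on `T^n`: linear functionals on `C^∞(T^n)` that are continuous, that is,
bounded by a constant times a `C^m` norm (`‖u φ‖ ≤ C M` whenever `M` bounds all derivatives of `φ`
of order at most `m`). -/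
def PeriodicDistribution {n : ℕ} (r : Fin n → ℝ) : Submodule ℂ (PeriodicTest r →ₗ[ℂ] ℂ) where
  carrier := {u | ∃ (C : ℝ) (m : ℕ), ∀ (φ : PeriodicTest r) (M : ℝ),
    (∀ j ≤ m, ∀ x, ‖iteratedFDeriv ℝ j (φ : EuclideanSpace ℝ (Fin n) → ℂ) x‖ ≤ M) →
      ‖u φ‖ ≤ C * M}
  add_mem' := by
    rintro u v ⟨C, m, hu⟩ ⟨C', m', hv⟩
    refine ⟨C + C', max m m', fun φ M hM => ?_⟩
    have h₁ := hu φ M fun j hj x => hM j (hj.trans (le_max_left _ _)) x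
    have h₂ := hv φ M fun j hj x => hM j (hj.trans (le_max_right _ _)) x
    calc ‖(u + v) φ‖ ≤ ‖u φ‖ + ‖v φ‖ := norm_add_le _ _
      _ ≤ (C + C') * M := by linarith
  zero_mem' := ⟨0, 0, fun φ M _ => by simp⟩
  smul_mem' := by
    rintro c u ⟨C, m, hu⟩
    refine ⟨‖c‖ * C, m, fun φ M hM => ?_⟩
    calc ‖(c • u) φ‖ = ‖c‖ * ‖u φ‖ := by
          rw [LinearMap.smul_apply, smul_eq_mul, norm_mul]
      _ ≤ ‖c‖ * (C * M) := mul_le_mul_of_nonneg_left (hu φ M hM) (norm_nonneg _)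
      _ = ‖c‖ * C * M := by ring

/-! ### Fourier series and Sobolev spaces -/

/-- The frequency `ν_k = (2π k₁ / r₁, …, 2π kₙ / rₙ)`. -/
def freq {n : ℕ} (r : Fin n → ℝ) (k : Fin n → ℤ) : EuclideanSpace ℝ (Fin n) :=
  WithLp.toLp 2 fun i => 2 * Real.pi * (k i : ℝ) / r i

/-- The exponential `x ↦ e^{i ν_k · x}`, as a periodic test function. -/
def character {n : ℕ} (r : Fin n → ℝ) (k : Fin n → ℤ) : PeriodicTest r :=
  ⟨fun x => Complex.exp (Complex.I * ((inner ℝ (freq r k) x : ℝ) : ℂ)), by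
    refine ⟨?_, fun i x => ?_⟩
    · exact (contDiff_const.mul
        (Complex.ofRealCLM.contDiff.comp (contDiff_const.inner ℝ contDiff_id))).cexp
    · beta_reduce
      rw [inner_add_right, EuclideanSpace.inner_single_right]
      by_cases hr : r i = 0
      · simp [hr]
      · have h : (r i) * (freq r k).ofLp i = k i * (2 * Real.pi) := by
          simp only [freq]
          field_simp
        simp only [conj_trivial, h]
        rw [Complex.exp_eq_exp_iff_exists_int]
        exact ⟨k i, by push_cast; ring⟩⟩

/-- The cell `∏ [0, r i]`. -/
def cell {n : ℕ} (r : Fin n → ℝ) : Set (EuclideanSpace ℝ (Fin n)) :=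
  {x | ∀ i, 0 ≤ x i ∧ x i ≤ r i}

/-- The Fourier coefficient `ĥ_k = |T^n|⁻¹ ⟨h, e^{-i ν_k · x}⟩`. -/
def distCoeff {n : ℕ} {r : Fin n → ℝ} (h : PeriodicDistribution r) (k : Fin n → ℤ) : ℂ :=
  ((∏ i, r i : ℝ) : ℂ)⁻¹ * h.1 (character r (-k))

/-- `W = ∑_k c_k e^{i ν_k · x}` in the sense of periodic distributions: for each test function `φ`,
`⟨W, φ⟩ = ∑_k c_k ∫_{T^n} e^{i ν_k · x} φ(x) dx` as a convergent sum. -/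
def HasFourierSeries {n : ℕ} {r : Fin n → ℝ} (c : (Fin n → ℤ) → ℂ)
    (W : PeriodicDistribution r) : Prop :=
  ∀ φ : PeriodicTest r,
    HasSum (fun k => c k * ∫ x in cell r, (character r k).1 x * φ.1 x) (W.1 φ)

/-- `‖h‖²_{H^q(T^n)} = ∑_k (1 + ‖k‖²)^q |ĥ_k|²`, with values in `[0, ∞]`. -/
def sobolevNormSq {n : ℕ} {r : Fin n → ℝ} (q : ℝ) (h : PeriodicDistribution r) : ℝ≥0∞ :=
  ∑' k : Fin n → ℤ, ENNReal.ofReal ((1 + ∑ i, (k i : ℝ) ^ 2) ^ q * ‖distCoeff h k‖ ^ 2)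

/-- `h ∈ H^q(T^n)`. -/
def MemSobolev {n : ℕ} {r : Fin n → ℝ} (q : ℝ) (h : PeriodicDistribution r) : Prop :=
  sobolevNormSq q h < ⊤

/-! ### The multipliers and the nonlocal operator -/

/-- The generalized hypergeometric series `₂F₃(a₁, a₂; b₁, b₂, b₃; z)`. -/
def hypergeometric23 (a₁ a₂ b₁ b₂ b₃ z : ℝ) : ℝ :=
  ∑' j : ℕ, (ascPochhammer ℝ j).eval a₁ * (ascPochhammer ℝ j).eval a₂ /
    ((ascPochhammer ℝ j).eval b₁ * (ascPochhammer ℝ j).eval b₂ * (ascPochhammer ℝ j).eval b₃) *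
      (z ^ j / (Nat.factorial j : ℝ))

/-- The scaling constant `c^{δ,β}` in dimension `n`. -/
def scalingConst (n : ℕ) (δ β : ℝ) : ℝ :=
  2 * (n + 2 - β) * Real.Gamma ((n : ℝ) / 2 + 1) /
    (Real.pi ^ ((n : ℝ) / 2) * δ ^ ((n : ℝ) + 2 - β))

open Classical in
/-- The multipliers `m^{δ,β}(ν)`: for `β < n + 2` the integral
`c^{δ,β} ∫_{B_δ(0)} (cos(ν · z) - 1) / ‖z‖^β dz`, extended to `β ≥ n + 2` by
`-‖ν‖² ₂F₃(1, (n+2-β)/2; 2, (n+2)/2, (n+4-β)/2; -‖ν‖²δ²/4)`. -/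
def multiplier {n : ℕ} (δ β : ℝ) (ν : EuclideanSpace ℝ (Fin n)) : ℝ :=
  if β < n + 2 then
    scalingConst n δ β *
      ∫ z in Metric.ball (0 : EuclideanSpace ℝ (Fin n)) δ, (Real.cos (inner ℝ ν z) - 1) / ‖z‖ ^ β
  else
    -‖ν‖ ^ 2 * hypergeometric23 1 (((n : ℝ) + 2 - β) / 2) 2 (((n : ℝ) + 2) / 2)
      (((n : ℝ) + 4 - β) / 2) (-(1 / 4) * ‖ν‖ ^ 2 * δ ^ 2)

/-- `W = L^{δ,β} J`, that is, `W = ∑_k m(ν_k) Ĵ_k e^{i ν_k · x}`. -/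
def IsNonlocalLaplacian {n : ℕ} {r : Fin n → ℝ} (δ β : ℝ) (J W : PeriodicDistribution r) : Prop :=
  HasFourierSeries (fun k => (multiplier δ β (freq r k) : ℂ) * distCoeff J k) W

/-! ### Time derivatives, smoothness, solutions -/

/-- `V` is the Gateaux derivative at time `t` of the `H^q(T^n)`-valued function `U` (defined near
`t`): `‖(U(t + h) - U(t)) / h - V‖²_{H^q} → 0` as `h → 0`. -/
def HasGateauxDerivAt {n : ℕ} {r : Fin n → ℝ} (q : ℝ) (U : ℝ → PeriodicDistribution r)
    (V : PeriodicDistribution r) (t : ℝ) : Prop :=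
  (∀ᶠ τ in 𝓝 t, MemSobolev q (U τ)) ∧ MemSobolev q V ∧
    Tendsto (fun h : ℝ => sobolevNormSq q (((h⁻¹ : ℝ) : ℂ) • (U (t + h) - U t) - V))
      (𝓝[≠] 0) (𝓝 0)

/-- `U ∈ C^∞((0,∞); H^p(T^n))`, where `p` may depend on time: near each `t > 0`, `U` is
an `H^{p(t)}(T^n)`-valued function with Gateaux derivatives of all orders in `H^{p(t)}(T^n)`. -/
def SmoothInto {n : ℕ} {r : Fin n → ℝ} (p : ℝ → ℝ) (U : ℝ → PeriodicDistribution r) : Prop :=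
  ∀ t, 0 < t → ∃ D : ℕ → ℝ → PeriodicDistribution r, ∀ᶠ τ in 𝓝 t,
    D 0 τ = U τ ∧ ∀ N, HasGateauxDerivAt (p t) (D N) (D (N + 1) τ) τ

/-- `U : [0,∞) → H^s(T^n)` solves `dU/dt = L^{δ,β} U`, `U(0) = f`, the time derivative being the
Gateaux derivative in `H^q(T^n)` for `t > 0`, and the initial value being attained in the sense of
distributions. Only the values of `U` on `[0,∞)` matter. -/
structure IsSolution {n : ℕ} {r : Fin n → ℝ} (δ β s q : ℝ) (f : PeriodicDistribution r)
    (U : ℝ → PeriodicDistribution r) : Prop where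
  mem : ∀ t, 0 ≤ t → MemSobolev s (U t)
  initial : U 0 = f
  tendsto_initial : ∀ φ : PeriodicTest r, Tendsto (fun t => (U t).1 φ) (𝓝[>] 0) (𝓝 (f.1 φ))
  equation : ∀ t, 0 < t → ∃ V, IsNonlocalLaplacian δ β (U t) V ∧ HasGateauxDerivAt q U V t

end NonlocalDiffusion

end

open NonlocalDiffusion

noncomputable section

namespace NonlocalDiffusion

/-! ### Integration over the period cell -/

/-! On Fourier coefficients the equation decouples into the scalar equations `u' = m(ν_k) u`, whose
solutions are `f̂_k e^{m(ν_k) t}`. The proof makes this legitimate for distributions and then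
measures how fast these factors decay in `k`.

Distributions and coefficients. Integration by parts shows that smooth periodic functions have
rapidly decreasing coefficients, so every coefficient sequence of polynomial growth sums to a
distribution (`exists_hasFourierSeries`). Conversely the Fourier series of a test function converges
in every `C^m` norm, so a distribution is the sum of its own Fourier series and is determined by its
coefficients (`hasFourierSeries_distCoeff`, `distribution_ext`).

Multipliers. Three facts are needed: `m ≤ 0`, polynomial growth of `|m|`, and logarithmic upper
bounds `m(ν) ≤ C - σ log ‖ν‖`. For `β = n` the measure `‖z‖^{-n} dz` is scale invariant, so each
halving of `ν` removes an annulus integral, which by Riemann–Lebesgue tends to a constant times `log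
2`; this gives every `σ < 4n/δ²`. For `n < β < n + 2` comparison with `β = n` on small balls gives
every `σ`. For `β ≥ n + 2` the hypergeometric function minus `1` is a nonnegative multiple of an
iterated Beta average of `1 - cos (2√y)`, whence `m ≤ -‖ν‖²` (`hypergeometric23_bounds`).

Regularity. A logarithmic bound turns `e^{m t}` into a negative power of `1 + ‖k‖²`, which is a gain
of Sobolev order (`SmoothingGain`). The gain is taken at a time `t₁ < t`; the remaining time absorbs
all powers of `m` through `x^N e^{-x} ≤ N!`, so time derivatives of every order exist with no
further loss (`IsPropagator.hasGateauxDerivAt`). For `β < n` the bound `m ≤ 0` alone suffices.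

Uniqueness. Convergence in any `H^q` implies convergence of each coefficient, so every solution
satisfies the scalar equations (`IsSolution.distCoeff_eq`), whatever `q` is. -/

lemma periodic_add_intVector {n : ℕ} {r : Fin n → ℝ} {α : Type*}
    {ψ : EuclideanSpace ℝ (Fin n) → α}
    (hψ : ∀ i x, ψ (x + EuclideanSpace.single i (r i)) = ψ x) (k : Fin n → ℤ)
    (x : EuclideanSpace ℝ (Fin n)) :
    ψ (x + WithLp.toLp 2 fun i => r i * k i) = ψ x := by
  have h : (WithLp.toLp 2 fun i => r i * (k i : ℝ)) =
      ∑ i, k i • (EuclideanSpace.single i (r i) : EuclideanSpace ℝ (Fin n)) := by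
    ext j
    simp [Pi.single_apply, mul_comm]
  rw [h]
  have key : ∀ s : Finset (Fin n), ∀ y, ψ (y + ∑ i ∈ s, k i •
      (EuclideanSpace.single i (r i) : EuclideanSpace ℝ (Fin n))) = ψ y := by
    intro s
    induction s using Finset.induction_on with
    | empty => simp
    | insert a s ha ih =>
      intro y
      have hp : Function.Periodic ψ (EuclideanSpace.single a (r a)) := hψ a
      rw [Finset.sum_insert ha, ← add_assoc, ih]
      exact hp.zsmul (k a) y
  exact key _ x

/-- After rescaling the coordinates to period `1`, a periodic function factors through the quotient
map onto the compact torus. This makes Haar measure and the Fourier series on `UnitAddTorus`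
available. -/
lemma exists_torus_lift {n : ℕ} {r : Fin n → ℝ} {ψ : EuclideanSpace ℝ (Fin n) → ℂ}
    (hc : Continuous ψ) (hψ : ∀ i x, ψ (x + EuclideanSpace.single i (r i)) = ψ x) :
    ∃ g : C(UnitAddTorus (Fin n), ℂ), ∀ x : Fin n → ℝ,
      g (fun i => (x i : UnitAddCircle)) = ψ (WithLp.toLp 2 fun i => r i * x i) := by
  have hq : IsOpenQuotientMap (Pi.map fun (_ : Fin n) (x : ℝ) => (x : UnitAddCircle)) :=
    IsOpenQuotientMap.piMap fun _ => QuotientAddGroup.isOpenQuotientMap_mk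
  let Q : C(Fin n → ℝ, UnitAddTorus (Fin n)) := ⟨_, hq.continuous⟩
  have hQ : IsQuotientMap Q := hq.isQuotientMap
  let F : C(Fin n → ℝ, ℂ) := ⟨fun x => ψ (WithLp.toLp 2 fun i => r i * x i), by fun_prop⟩
  have hF : Function.FactorsThrough F Q := by
    intro a b hab
    have h : ∀ i, ∃ m : ℤ, a i = b i + m := by
      intro i
      have h1 : (a i : UnitAddCircle) = b i := congrFun hab i
      rw [← sub_eq_zero, ← AddCircle.coe_sub, AddCircle.coe_eq_zero_iff] at h1
      obtain ⟨m, hm⟩ := h1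
      exact ⟨m, by simp at hm; linarith⟩
    choose m hm using h
    have : (WithLp.toLp 2 fun i => r i * a i) = (WithLp.toLp 2 fun i => r i * b i) +
        WithLp.toLp 2 fun i => r i * (m i : ℝ) := by
      ext i
      simp [hm, mul_add]
    change ψ _ = ψ _
    rw [this, periodic_add_intVector hψ]
  exact ⟨hQ.lift F hF, fun x => congrFun (congrArg DFunLike.coe (hQ.lift_comp F hF)) x⟩

lemma integral_cell_eq {n : ℕ} {r : Fin n → ℝ} (hr : ∀ i, 0 < r i)
    (ψ : EuclideanSpace ℝ (Fin n) → ℂ) :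
    ∫ x in cell r, ψ x = ((∏ i, r i : ℝ) : ℂ) *
      ∫ x in {x : Fin n → ℝ | ∀ i, x i ∈ Set.Ioc (0 : ℝ) (0 + 1)},
        ψ (WithLp.toLp 2 fun i => r i * x i) := by
  let e : (Fin n → ℝ) ≃ₜ (Fin n → ℝ) :=
    Homeomorph.piCongrRight fun i => Homeomorph.mulLeft₀ (r i) (hr i).ne'
  have he : ∀ x, e x = fun i => r i * x i := fun x => rfl
  have hprod : 0 < ∏ i, r i := Finset.prod_pos fun i _ => hr i
  have hdet : (Matrix.diagonal r).det = ∏ i, r i := Matrix.det_diagonal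
  have hvol := Real.smul_map_diagonal_volume_pi (D := r) (by rw [hdet]; exact hprod.ne')
  have hmap : Measure.map (Matrix.toLin' (Matrix.diagonal r)) volume = Measure.map e volume := by
    congr 1
    ext x i
    simp [he, Matrix.mulVec_diagonal]
  rw [hdet, abs_of_pos hprod, hmap] at hvol
  have h1 : ∫ x in cell r, ψ x =
      ∫ y in (WithLp.toLp 2) ⁻¹' (cell r), ψ (WithLp.toLp 2 y) :=
    ((EuclideanSpace.volume_preserving_symm_measurableEquiv_toLp (Fin n)).symm.setIntegral_preimage_emb
      (MeasurableEquiv.measurableEmbedding _) _ _).symm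
  rw [h1]
  conv_lhs => rw [← hvol]
  rw [Measure.restrict_smul, integral_smul_measure, ENNReal.toReal_ofReal hprod.le,
    e.measurableEmbedding.setIntegral_map, Complex.real_smul]
  congr 1
  have h2 : (e ⁻¹' ((WithLp.toLp 2) ⁻¹' (cell r))) = Set.Icc (0 : Fin n → ℝ) 1 := by
    ext x
    simp only [Set.mem_preimage, cell, Set.mem_ofPred_eq, he, Set.mem_Icc, Pi.le_def,
      ← forall_and]
    refine forall_congr' fun i => ?_
    simp [hr i, mul_nonneg_iff_of_pos_left]
  have h3 : {x : Fin n → ℝ | ∀ i, x i ∈ Set.Ioc (0 : ℝ) (0 + 1)} =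
      Set.pi Set.univ fun i => Set.Ioc ((0 : Fin n → ℝ) i) ((1 : Fin n → ℝ) i) := by
    ext x; simp
  rw [h2, h3]
  exact (setIntegral_congr_set (Measure.univ_pi_Ioc_ae_eq_Icc (f := 0) (g := 1))).symm

/-- The cell integral is a multiple of the integral over the torus, whose measure is translation
invariant. -/
lemma integral_cell_add {n : ℕ} {r : Fin n → ℝ} (hr : ∀ i, 0 < r i)
    {ψ : EuclideanSpace ℝ (Fin n) → ℂ} (hc : Continuous ψ)
    (hψ : ∀ i x, ψ (x + EuclideanSpace.single i (r i)) = ψ x)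
    (v : EuclideanSpace ℝ (Fin n)) :
    ∫ x in cell r, ψ (x + v) = ∫ x in cell r, ψ x := by
  obtain ⟨g, hg⟩ := exists_torus_lift hc hψ
  let S : Set (Fin n → ℝ) := {x : Fin n → ℝ | ∀ i, x i ∈ Set.Ioc (0 : ℝ) (0 + 1)}
  have hmp := measurePreserving_pi (fun _ : Fin n => (volume.restrict (Set.Ioc (0 : ℝ) (0 + 1))))
    (fun _ => (volume : Measure UnitAddCircle))
    (fun i => AddCircle.measurePreserving_mk 1 (0 : ℝ))
  have hS : volume.restrict S = Measure.pi
      (fun _ : Fin n => (volume.restrict (Set.Ioc (0 : ℝ) (0 + 1)))) := by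
    rw [← Measure.restrict_pi_pi]
    congr 1
    ext x; simp [S]
  rw [← hS] at hmp
  have key : ∀ w : UnitAddTorus (Fin n), ∫ x in S, g ((fun i => (x i : UnitAddCircle)) + w) =
      ∫ y, g y ∂(Measure.pi fun _ : Fin n => (volume : Measure UnitAddCircle)) := by
    intro w
    rw [← integral_add_right_eq_self (fun y => g y) w, ← hmp.map_eq,
      integral_map hmp.measurable.aemeasurable]
    exact (Continuous.aestronglyMeasurable (by fun_prop))
  rw [integral_cell_eq hr, integral_cell_eq hr]
  congr 1
  have h0 := key 0
  have h1 := key fun i => ((v i / r i : ℝ) : UnitAddCircle)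
  rw [← h0] at h1
  convert h1 using 2
  · ext x
    have := hg (fun i => x i + v i / r i)
    simp only [AddCircle.coe_add] at this
    refine Eq.trans ?_ this.symm
    congr 1
    ext i
    have := (hr i).ne'
    simp
    field_simp
  · ext x
    rw [add_zero, hg]

end NonlocalDiffusion

namespace NonlocalDiffusion

/-! ### The lattice weight -/

/-- The weight `1 + ‖k‖²` on `ℤ^n`. -/
def latticeWeight {n : ℕ} (k : Fin n → ℤ) : ℝ := 1 + ∑ i, (k i : ℝ) ^ 2

lemma one_le_latticeWeight {n : ℕ} (k : Fin n → ℤ) : 1 ≤ latticeWeight k :=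
  le_add_of_nonneg_right (Finset.sum_nonneg fun _ _ => sq_nonneg _)

lemma latticeWeight_pos {n : ℕ} (k : Fin n → ℤ) : 0 < latticeWeight k :=
  one_pos.trans_le (one_le_latticeWeight k)

lemma latticeWeight_neg {n : ℕ} (k : Fin n → ℤ) : latticeWeight (-k) = latticeWeight k := by
  simp [latticeWeight]

lemma summable_inv_one_add_int_sq : Summable fun m : ℤ => (1 + (m : ℝ) ^ 2)⁻¹ := by
  refine Summable.of_norm_bounded_eventually
    ((Real.summable_one_div_int_pow (p := 2)).2 one_lt_two) ?_
  filter_upwards [(Set.finite_singleton (0 : ℤ)).compl_mem_cofinite] with m hm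
  have hm : (m : ℝ) ≠ 0 := by exact_mod_cast hm
  rw [Real.norm_of_nonneg (by positivity), one_div]
  gcongr
  linarith

lemma summable_prod_apply {ι : Type*} [Fintype ι] [DecidableEq ι] {α : Type*} {g : α → ℝ}
    (hg : ∀ m, 0 ≤ g m) (hs : Summable g) : Summable fun k : ι → α => ∏ i, g (k i) := by
  classical
  have h0 : ∀ k : ι → α, 0 ≤ ∏ i, g (k i) := fun k => Finset.prod_nonneg fun i _ => hg _
  refine summable_of_sum_le (c := ∏ _i : ι, ∑' m, g m) h0 fun S => ?_
  let T : ι → Finset α := fun i => S.image fun k => k i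
  have hST : S ⊆ Fintype.piFinset T := by
    intro k hk
    rw [Fintype.mem_piFinset]
    intro i
    exact Finset.mem_image.2 ⟨k, hk, rfl⟩
  refine (Finset.sum_le_sum_of_subset_of_nonneg hST fun k _ _ => h0 k).trans ?_
  rw [← Finset.prod_univ_sum T fun _ => g]
  exact Finset.prod_le_prod (fun i _ => Finset.sum_nonneg fun m _ => hg m)
    fun i _ => hs.sum_le_tsum _ fun m _ => hg m

/-- Since `∏ (1 + k_i²) ≤ (1 + ‖k‖²)^n`, the series is dominated by a product of one-dimensional
ones. The exponent is not sharp, but it is enough to sum rapidly decreasing sequences. -/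
lemma summable_inv_latticeWeight_pow (n : ℕ) :
    Summable fun k : Fin n → ℤ => (latticeWeight k ^ n)⁻¹ := by
  have h1 : Summable fun k : Fin n → ℤ => ∏ i, (1 + (k i : ℝ) ^ 2)⁻¹ :=
    summable_prod_apply (g := fun m : ℤ => (1 + (m : ℝ) ^ 2)⁻¹) (fun m => by positivity)
      summable_inv_one_add_int_sq
  refine Summable.of_nonneg_of_le (fun k => by have := latticeWeight_pos k; positivity)
    (fun k => ?_) h1
  rw [Finset.prod_inv_distrib]
  refine inv_anti₀ (Finset.prod_pos fun i _ => by positivity) ?_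
  calc ∏ i, (1 + (k i : ℝ) ^ 2) ≤ ∏ i : Fin n, latticeWeight k := by
        refine Finset.prod_le_prod (fun i _ => by positivity) fun i _ => ?_
        rw [latticeWeight]
        gcongr
        exact Finset.single_le_sum (f := fun i => (k i : ℝ) ^ 2) (fun j _ => sq_nonneg _)
          (Finset.mem_univ i)
    _ = latticeWeight k ^ n := by simp

/-- The power mean inequality for the `n + 1` numbers `1, k_1², …, k_n²`, indexed by `Option (Fin
n)` with `none` carrying the `1`. It reduces powers of the weight to pure derivatives in single
coordinates. -/
lemma latticeWeight_pow_succ_le {n : ℕ} (k : Fin n → ℤ) (m : ℕ) :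
    latticeWeight k ^ (m + 1) ≤
      ((n : ℝ) + 1) ^ m * (1 + ∑ i, |(k i : ℝ)| ^ (2 * (m + 1))) := by
  have h := pow_sum_le_card_mul_sum_pow (s := (Finset.univ : Finset (Option (Fin n))))
    (f := fun o => o.elim (1 : ℝ) fun i => (k i : ℝ) ^ 2)
    (fun o _ => by cases o <;> simp [sq_nonneg]) m
  simpa [Fintype.sum_option, latticeWeight, pow_mul, sq_abs] using h

/-! ### Calculus of periodic test functions -/

variable {n : ℕ} {r : Fin n → ℝ}

lemma contDiff_test (φ : PeriodicTest r) : ContDiff ℝ ∞ φ.1 := φ.2.1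

lemma continuous_test (φ : PeriodicTest r) : Continuous φ.1 := φ.2.1.continuous

lemma differentiable_test (φ : PeriodicTest r) : Differentiable ℝ φ.1 :=
  φ.2.1.differentiable (by simp)

/-- The partial derivative in the `i`-th coordinate. -/
def partialDeriv (i : Fin n) (φ : PeriodicTest r) : PeriodicTest r :=
  ⟨fun x => fderiv ℝ φ.1 x (EuclideanSpace.single i 1),
    ((contDiff_test φ).fderiv_right (m := ∞) (by simp)).clm_apply contDiff_const, fun j x => by
      have h : (fun y => φ.1 (y + EuclideanSpace.single j (r j))) = φ.1 := funext (φ.2.2 j)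
      beta_reduce
      rw [← fderiv_comp_add_right, h]⟩

/-- The product of two periodic test functions. -/
def mulTest (φ ψ : PeriodicTest r) : PeriodicTest r :=
  ⟨fun x => φ.1 x * ψ.1 x, (contDiff_test φ).mul (contDiff_test ψ), fun i x => by
    beta_reduce
    rw [φ.2.2, ψ.2.2]⟩

lemma partialDeriv_iterate_apply (i : Fin n) (φ : PeriodicTest r) (N : ℕ)
    (x : EuclideanSpace ℝ (Fin n)) : ((partialDeriv i)^[N] φ).1 x =
      iteratedFDeriv ℝ N φ.1 x fun _ => EuclideanSpace.single i 1 := by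
  induction N generalizing x with
  | zero => simp
  | succ N ih =>
    rw [Function.iterate_succ_apply', iteratedFDeriv_succ_apply_left]
    have h : ((partialDeriv i)^[N] φ).1 =
        fun x => iteratedFDeriv ℝ N φ.1 x fun _ => EuclideanSpace.single i 1 := funext ih
    change fderiv ℝ ((partialDeriv i)^[N] φ).1 x _ = _
    rw [h]
    have hd : DifferentiableAt ℝ (iteratedFDeriv ℝ N φ.1) x :=
      ((contDiff_test φ).differentiable_iteratedFDeriv (by exact_mod_cast WithTop.coe_lt_top N)) x
    rw [fderiv_continuousMultilinear_apply_const_apply hd]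
    rfl

lemma isCompact_cell : IsCompact (cell r) := by
  have h : cell r = (EuclideanSpace.equiv (Fin n) ℝ).symm '' Set.Icc 0 r := by
    ext x
    constructor
    · intro hx
      exact ⟨x.ofLp, ⟨fun i => (hx i).1, fun i => (hx i).2⟩, rfl⟩
    · rintro ⟨y, hy, rfl⟩ i
      exact ⟨hy.1 i, hy.2 i⟩
  rw [h]
  exact isCompact_Icc.image (EuclideanSpace.equiv (Fin n) ℝ).symm.continuous

lemma exists_cell_representative (hr : ∀ i, 0 < r i) (x : EuclideanSpace ℝ (Fin n)) :
    ∃ y ∈ cell r, ∀ {α : Type} (ψ : EuclideanSpace ℝ (Fin n) → α),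
      (∀ i x, ψ (x + EuclideanSpace.single i (r i)) = ψ x) → ψ x = ψ y := by
  refine ⟨x + WithLp.toLp 2 fun i => r i * ((-⌊x i / r i⌋ : ℤ) : ℝ), fun i => ?_,
    fun ψ hψ => (periodic_add_intVector hψ _ x).symm⟩
  have h1 := Int.floor_le (x i / r i)
  have h2 := (Int.lt_floor_add_one (x i / r i)).le
  rw [le_div_iff₀ (hr i)] at h1
  rw [div_le_iff₀ (hr i)] at h2
  simp only [PiLp.add_apply]
  push_cast
  constructor <;> linarith

lemma exists_bound_test (hr : ∀ i, 0 < r i) (φ : PeriodicTest r) :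
    ∃ C, ∀ x, ‖φ.1 x‖ ≤ C := by
  obtain ⟨C, hC⟩ := (isCompact_cell (r := r)).exists_bound_of_continuousOn (continuous_test φ).continuousOn
  refine ⟨C, fun x => ?_⟩
  obtain ⟨y, hy, h⟩ := exists_cell_representative hr x
  rw [h φ.1 φ.2.2]
  exact hC y hy

/-- By translation invariance `t ↦ ∫ φ(x + t e_i) dx` is constant; its derivative at `0`, taken
under the integral sign, is the integral in question. -/
lemma integral_partialDeriv (hr : ∀ i, 0 < r i) (i : Fin n) (φ : PeriodicTest r) :
    ∫ x in cell r, (partialDeriv i φ).1 x = 0 := by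
  obtain ⟨C, hC⟩ := exists_bound_test hr (partialDeriv i φ)
  have hfin : IsFiniteMeasure (volume.restrict (cell r)) :=
    ⟨by simpa using (isCompact_cell (r := r)).measure_lt_top⟩
  have hint : ∀ ψ : PeriodicTest r, Integrable ψ.1 (volume.restrict (cell r)) := fun ψ =>
    (continuous_test ψ).continuousOn.integrableOn_compact isCompact_cell
  have h := hasDerivAt_integral_of_dominated_loc_of_deriv_le (μ := volume.restrict (cell r))
    (F := fun (t : ℝ) x => φ.1 (x + t • EuclideanSpace.single i (1 : ℝ)))
    (F' := fun (t : ℝ) x => (partialDeriv i φ).1 (x + t • EuclideanSpace.single i (1 : ℝ)))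
    (x₀ := 0) (s := Set.univ) (bound := fun _ => C) univ_mem
    (Eventually.of_forall fun t => ((continuous_test φ).comp (by fun_prop)).aestronglyMeasurable)
    (by simpa using hint φ)
    (((continuous_test (partialDeriv i φ)).comp (by fun_prop)).aestronglyMeasurable)
    (Eventually.of_forall fun x t _ => hC _) (integrable_const C)
    (Eventually.of_forall fun x t _ => by
      have h1 : HasDerivAt (fun t : ℝ => x + t • EuclideanSpace.single i (1 : ℝ))
          (EuclideanSpace.single i (1 : ℝ)) t := by
        simpa using ((hasDerivAt_id t).smul_const (EuclideanSpace.single i (1 : ℝ))).const_add x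
      exact ((differentiable_test φ) _).hasFDerivAt.comp_hasDerivAt t h1)
  have h2 : (fun t : ℝ => ∫ x in cell r, φ.1 (x + t • EuclideanSpace.single i (1 : ℝ))) =
      fun _ => ∫ x in cell r, φ.1 x :=
    funext fun t => integral_cell_add hr (continuous_test φ) φ.2.2 _
  have h3 := h.2
  rw [h2] at h3
  simpa using h3.unique (hasDerivAt_const (0 : ℝ) (∫ x in cell r, φ.1 x))

/-! ### Fourier coefficients of test functions -/

/-- The pairing `∫_{T^n} e^{i ν_k · x} φ(x) dx`. -/
def testCoeff (k : Fin n → ℤ) (φ : PeriodicTest r) : ℂ :=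
  ∫ x in cell r, (character r k).1 x * φ.1 x

lemma norm_character (k : Fin n → ℤ) (x : EuclideanSpace ℝ (Fin n)) :
    ‖(character r k).1 x‖ = 1 := by
  change ‖Complex.exp _‖ = 1
  rw [mul_comm, Complex.norm_exp_ofReal_mul_I]

lemma partialDeriv_character (i : Fin n) (k : Fin n → ℤ) (x : EuclideanSpace ℝ (Fin n)) :
    (partialDeriv i (character r k)).1 x =
      Complex.I * (freq r k i : ℝ) * (character r k).1 x := by
  have h1 : HasFDerivAt (fun x : EuclideanSpace ℝ (Fin n) => ((inner ℝ (freq r k) x : ℝ) : ℂ))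
      (Complex.ofRealCLM.comp (innerSL ℝ (freq r k))) x :=
    (Complex.ofRealCLM.comp (innerSL ℝ (freq r k))).hasFDerivAt
  have h2 := (h1.const_mul Complex.I).cexp
  change fderiv ℝ (fun x => Complex.exp (Complex.I * ((inner ℝ (freq r k) x : ℝ) : ℂ))) x _ =
    _ * Complex.exp _
  rw [h2.fderiv]
  simp [EuclideanSpace.inner_single_right]
  ring

/-- Integration by parts: the partial derivative of the product of the character and `φ` integrates
to zero. -/
lemma testCoeff_partialDeriv (hr : ∀ i, 0 < r i) (i : Fin n) (k : Fin n → ℤ)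
    (φ : PeriodicTest r) : testCoeff k (partialDeriv i φ) =
      -(Complex.I * (freq r k i : ℝ)) * testCoeff k φ := by
  have h := integral_partialDeriv hr i (mulTest (character r k) φ)
  have h1 : ∀ x, (partialDeriv i (mulTest (character r k) φ)).1 x =
      (character r k).1 x * (partialDeriv i φ).1 x +
        Complex.I * (freq r k i : ℝ) * ((character r k).1 x * φ.1 x) := by
    intro x
    change fderiv ℝ (fun x => (character r k).1 x * φ.1 x) x _ = _
    rw [fderiv_fun_mul (differentiable_test (character r k) x) ((differentiable_test φ) x)]
    have := partialDeriv_character (r := r) i k x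
    change fderiv ℝ (character r k).1 x _ = _ at this
    simp only [add_apply, smul_apply, smul_eq_mul, this]
    change _ = _ * fderiv ℝ φ.1 x _ + _
    ring
  simp only [h1] at h
  have hint : ∀ ψ : PeriodicTest r, Integrable ψ.1 (volume.restrict (cell r)) := fun ψ =>
    (continuous_test ψ).continuousOn.integrableOn_compact isCompact_cell
  have hi1 : Integrable (fun x => (character r k).1 x * (partialDeriv i φ).1 x)
      (volume.restrict (cell r)) := hint (mulTest (character r k) (partialDeriv i φ))
  have hi2 : Integrable (fun x => (character r k).1 x * φ.1 x)
      (volume.restrict (cell r)) := hint (mulTest (character r k) φ)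
  rw [integral_add hi1 (hi2.const_mul _), integral_const_mul] at h
  rw [testCoeff, testCoeff]
  linear_combination h

lemma measureReal_cell (hr : ∀ i, 0 < r i) : volume.real (cell r) = ∏ i, r i := by
  have h := integral_cell_eq hr fun _ => 1
  have hS : {x : Fin n → ℝ | ∀ i, x i ∈ Set.Ioc (0 : ℝ) (0 + 1)} =
      Set.pi Set.univ fun i => Set.Ioc (0 : ℝ) 1 := by
    ext x; simp
  rw [hS] at h
  simp [Measure.real, volume_pi_pi] at h
  exact_mod_cast h

lemma norm_testCoeff_le (hr : ∀ i, 0 < r i) (k : Fin n → ℤ) (φ : PeriodicTest r) {M : ℝ}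
    (hM : ∀ x, ‖φ.1 x‖ ≤ M) : ‖testCoeff k φ‖ ≤ (∏ i, r i) * M := by
  rw [← measureReal_cell hr, mul_comm]
  refine norm_setIntegral_le_of_norm_le_const isCompact_cell.measure_lt_top fun x _ => ?_
  rw [norm_mul, norm_character, one_mul]
  exact hM x

lemma norm_freq_pow_mul_testCoeff_le (hr : ∀ i, 0 < r i) (i : Fin n) (k : Fin n → ℤ)
    (φ : PeriodicTest r) (N : ℕ) {M : ℝ} (hM : ∀ x, ‖iteratedFDeriv ℝ N φ.1 x‖ ≤ M) :
    |freq r k i| ^ N * ‖testCoeff k φ‖ ≤ (∏ i, r i) * M := by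
  have h1 : ∀ N, ‖testCoeff k ((partialDeriv i)^[N] φ)‖ = |freq r k i| ^ N * ‖testCoeff k φ‖ := by
    intro N
    induction N with
    | zero => simp
    | succ N ih =>
      rw [Function.iterate_succ_apply', testCoeff_partialDeriv hr, norm_mul, ih, pow_succ]
      simp
      ring
  rw [← h1]
  refine norm_testCoeff_le hr k _ fun x => ?_
  rw [partialDeriv_iterate_apply]
  refine (ContinuousMultilinearMap.le_opNorm _ _).trans ?_
  simpa using hM x

/-- Rapid decay of the coefficients, obtained by repeated integration by parts. That `K` does not
depend on `φ` is what later makes synthesized functionals continuous. -/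
lemma latticeWeight_pow_mul_testCoeff_le (hr : ∀ i, 0 < r i) (m : ℕ) :
    ∃ K, 0 ≤ K ∧ ∀ (k : Fin n → ℤ) (φ : PeriodicTest r) (M : ℝ),
      (∀ j ≤ 2 * (m + 1), ∀ x, ‖iteratedFDeriv ℝ j φ.1 x‖ ≤ M) →
        latticeWeight k ^ (m + 1) * ‖testCoeff k φ‖ ≤ K * M := by
  have hprod : 0 ≤ ∏ i, r i := Finset.prod_nonneg fun i _ => (hr i).le
  refine ⟨((n : ℝ) + 1) ^ m * ((1 + ∑ i, (r i / (2 * Real.pi)) ^ (2 * (m + 1))) * ∏ i, r i),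
    ?_, fun k φ M hM => ?_⟩
  · have : ∀ i, 0 ≤ (r i / (2 * Real.pi)) ^ (2 * (m + 1)) := fun i => by
      have := hr i; positivity
    have := Finset.sum_nonneg fun i (_ : i ∈ Finset.univ) => this i
    positivity
  · have h0 : ‖testCoeff k φ‖ ≤ (∏ i, r i) * M :=
      norm_testCoeff_le hr k φ fun x => by simpa using hM 0 (Nat.zero_le _) x
    have h1 : ∀ i, |(k i : ℝ)| ^ (2 * (m + 1)) * ‖testCoeff k φ‖ ≤
        (r i / (2 * Real.pi)) ^ (2 * (m + 1)) * ((∏ i, r i) * M) := by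
      intro i
      have h2 := norm_freq_pow_mul_testCoeff_le hr i k φ _ (hM _ le_rfl)
      have h3 : |(k i : ℝ)| = r i / (2 * Real.pi) * |freq r k i| := by
        have : freq r k i = 2 * Real.pi * (k i : ℝ) / r i := rfl
        have hri := hr i
        rw [this, abs_div, abs_mul, abs_of_pos hri, abs_of_pos Real.two_pi_pos]
        field_simp
      rw [h3, mul_pow, mul_assoc]
      have := hr i
      gcongr
    calc latticeWeight k ^ (m + 1) * ‖testCoeff k φ‖
        ≤ ((n : ℝ) + 1) ^ m * (1 + ∑ i, |(k i : ℝ)| ^ (2 * (m + 1))) * ‖testCoeff k φ‖ := by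
          gcongr
          exact latticeWeight_pow_succ_le k m
      _ = ((n : ℝ) + 1) ^ m * (‖testCoeff k φ‖ +
            ∑ i, |(k i : ℝ)| ^ (2 * (m + 1)) * ‖testCoeff k φ‖) := by
          rw [← Finset.sum_mul]; ring
      _ ≤ ((n : ℝ) + 1) ^ m * ((∏ i, r i) * M +
            ∑ i, (r i / (2 * Real.pi)) ^ (2 * (m + 1)) * ((∏ i, r i) * M)) := by
          refine mul_le_mul_of_nonneg_left ?_ (by positivity)
          exact add_le_add h0 (Finset.sum_le_sum fun i _ => h1 i)
      _ = _ := by rw [← Finset.sum_mul]; ring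

lemma character_mul (j k : Fin n → ℤ) (x : EuclideanSpace ℝ (Fin n)) :
    (character r j).1 x * (character r k).1 x = (character r (j + k)).1 x := by
  have h : freq r (j + k) = freq r j + freq r k := by
    ext i
    simp [freq]
    ring
  change Complex.exp _ * Complex.exp _ = Complex.exp _
  rw [← Complex.exp_add, h, inner_add_left]
  push_cast
  ring_nf

/-- Orthogonality without computing an integral: for `j ≠ k`, differentiating the character of index
`j - k` in a coordinate where `j` and `k` differ multiplies it by a nonzero constant, yet the
derivative integrates to zero. -/
lemma testCoeff_character (hr : ∀ i, 0 < r i) (j k : Fin n → ℤ) :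
    testCoeff j (character r (-k)) = if j = k then ((∏ i, r i : ℝ) : ℂ) else 0 := by
  have h0 : testCoeff j (character r (-k)) = ∫ x in cell r, (character r (j - k)).1 x := by
    simp only [testCoeff, character_mul, sub_eq_add_neg]
  rw [h0]
  split_ifs with h
  · have h1 : ∀ x, (character r (j - k)).1 x = 1 := fun x => by
      have : freq r (j - k) = 0 := by ext i; simp [h, freq]
      change Complex.exp _ = 1
      simp [this]
    simp only [h1]
    rw [setIntegral_const, measureReal_cell hr]
    simp
  · obtain ⟨i, hi⟩ := Function.ne_iff.1 h
    have h1 := integral_partialDeriv hr i (character r (j - k))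
    simp only [partialDeriv_character, integral_const_mul] at h1
    refine (mul_eq_zero.1 h1).resolve_left ?_
    have h2 : freq r (j - k) i ≠ 0 := by
      have : freq r (j - k) i = 2 * Real.pi * ((j - k) i : ℤ) / r i := rfl
      rw [this]
      have h3 : (((j - k) i : ℤ) : ℝ) ≠ 0 := by
        simpa [sub_eq_zero] using hi
      have := (hr i).ne'
      have := Real.pi_ne_zero
      positivity
    simpa using h2

end NonlocalDiffusion

namespace NonlocalDiffusion

variable {n : ℕ} {r : Fin n → ℝ}

/-! ### Synthesis: distributions with prescribed Fourier coefficients -/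

lemma exists_bound_iteratedFDeriv (hr : ∀ i, 0 < r i) (φ : PeriodicTest r) (m : ℕ) :
    ∃ M, ∀ j ≤ m, ∀ x, ‖iteratedFDeriv ℝ j φ.1 x‖ ≤ M := by
  have h1 : ∀ j, ∃ M, ∀ x, ‖iteratedFDeriv ℝ j φ.1 x‖ ≤ M := by
    intro j
    have hper : ∀ i x, iteratedFDeriv ℝ j φ.1 (x + EuclideanSpace.single i (r i)) =
        iteratedFDeriv ℝ j φ.1 x := by
      intro i x
      have h : (fun y => φ.1 (y + EuclideanSpace.single i (r i))) = φ.1 := funext (φ.2.2 i)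
      rw [← iteratedFDeriv_comp_add_right, h]
    have hcont : Continuous (iteratedFDeriv ℝ j φ.1) :=
      (contDiff_test φ).continuous_iteratedFDeriv (by exact_mod_cast le_top)
    obtain ⟨M, hM⟩ := (isCompact_cell (r := r)).exists_bound_of_continuousOn hcont.continuousOn
    refine ⟨M, fun x => ?_⟩
    obtain ⟨y, hy, h⟩ := exists_cell_representative hr x
    rw [h _ hper]
    exact hM y hy
  choose M hM using h1
  refine ⟨∑ j ∈ Finset.range (m + 1), M j, fun j hj x => (hM j x).trans ?_⟩
  exact Finset.single_le_sum (f := M) (fun i _ => (norm_nonneg _).trans (hM i 0))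
    (Finset.mem_range.2 (Nat.lt_succ_of_le hj))

/-- Of the available decay, `N` powers of the weight cancel the growth of `c` and `n` powers are
kept for summability. -/
lemma norm_mul_testCoeff_le (hr : ∀ i, 0 < r i) (N : ℕ) :
    ∃ K, 0 ≤ K ∧ ∀ (C : ℝ) (c : (Fin n → ℤ) → ℂ), (∀ k, ‖c k‖ ≤ C * latticeWeight k ^ N) →
      ∀ (φ : PeriodicTest r) (M : ℝ),
        (∀ j ≤ 2 * (N + n + 1), ∀ x, ‖iteratedFDeriv ℝ j φ.1 x‖ ≤ M) →
          ∀ k, ‖c k * testCoeff k φ‖ ≤ C * K * M * (latticeWeight k ^ n)⁻¹ := by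
  obtain ⟨K, hK, h⟩ := latticeWeight_pow_mul_testCoeff_le hr (N + n)
  refine ⟨K, hK, fun C c hc φ M hM k => ?_⟩
  have hw := one_le_latticeWeight k
  have hw0 := latticeWeight_pos k
  have hC : 0 ≤ C := by
    have := (norm_nonneg _).trans (hc k)
    exact nonneg_of_mul_nonneg_left this (by positivity)
  have h1 := h k φ M hM
  rw [norm_mul, ← div_eq_mul_inv, le_div_iff₀ (by positivity)]
  calc ‖c k‖ * ‖testCoeff k φ‖ * latticeWeight k ^ n
      ≤ C * latticeWeight k ^ N * ‖testCoeff k φ‖ * latticeWeight k ^ n := by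
        gcongr
        exact hc k
    _ = C * (latticeWeight k ^ (N + n) * ‖testCoeff k φ‖) := by rw [pow_add]; ring
    _ ≤ C * (latticeWeight k ^ (N + n + 1) * ‖testCoeff k φ‖) := by
        exact mul_le_mul_of_nonneg_left (mul_le_mul_of_nonneg_right
          (pow_le_pow_right₀ hw (Nat.le_succ _)) (norm_nonneg _)) hC
    _ ≤ C * (K * M) := by gcongr
    _ = C * K * M := by ring

lemma summable_norm_mul_testCoeff (hr : ∀ i, 0 < r i) {N : ℕ} {C : ℝ} {c : (Fin n → ℤ) → ℂ}
    (hc : ∀ k, ‖c k‖ ≤ C * latticeWeight k ^ N) (φ : PeriodicTest r) :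
    Summable fun k => ‖c k * testCoeff k φ‖ := by
  obtain ⟨K, -, h⟩ := norm_mul_testCoeff_le hr N
  obtain ⟨M, hM⟩ := exists_bound_iteratedFDeriv hr φ (2 * (N + n + 1))
  exact Summable.of_nonneg_of_le (fun _ => norm_nonneg _) (h C c hc φ M hM)
    ((summable_inv_latticeWeight_pow n).mul_left _)

lemma testCoeff_add (k : Fin n → ℤ) (φ ψ : PeriodicTest r) :
    testCoeff k (φ + ψ) = testCoeff k φ + testCoeff k ψ := by
  have hint : ∀ ψ : PeriodicTest r,
      Integrable (fun x => (character r k).1 x * ψ.1 x) (volume.restrict (cell r)) := fun ψ =>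
    (continuous_test (mulTest (character r k) ψ)).continuousOn.integrableOn_compact isCompact_cell
  simp only [testCoeff]
  rw [← integral_add (hint φ) (hint ψ)]
  refine integral_congr_ae (Eventually.of_forall fun x => ?_)
  change _ * (φ.1 x + ψ.1 x) = _
  ring

lemma testCoeff_smul (k : Fin n → ℤ) (a : ℂ) (φ : PeriodicTest r) :
    testCoeff k (a • φ) = a * testCoeff k φ := by
  simp only [testCoeff]
  rw [← integral_const_mul]
  refine integral_congr_ae (Eventually.of_forall fun x => ?_)
  change _ * (a * φ.1 x) = _
  ring

lemma exists_hasFourierSeries (hr : ∀ i, 0 < r i) {N : ℕ} {C : ℝ} {c : (Fin n → ℤ) → ℂ}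
    (hc : ∀ k, ‖c k‖ ≤ C * latticeWeight k ^ N) :
    ∃ W : PeriodicDistribution r, HasFourierSeries c W := by
  have hs := fun φ => (summable_norm_mul_testCoeff hr hc φ).of_norm
  let W : PeriodicTest r →ₗ[ℂ] ℂ :=
    { toFun := fun φ => ∑' k, c k * testCoeff k φ
      map_add' := fun φ ψ => by
        simp only [testCoeff_add, mul_add]
        exact (hs φ).tsum_add (hs ψ)
      map_smul' := fun a φ => by
        simp only [testCoeff_smul, RingHom.id_apply, smul_eq_mul, ← tsum_mul_left]
        exact tsum_congr fun k => by ring }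
  obtain ⟨K, -, h⟩ := norm_mul_testCoeff_le hr N
  refine ⟨⟨W, C * K * ∑' k : Fin n → ℤ, (latticeWeight k ^ n)⁻¹, 2 * (N + n + 1),
    fun φ M hM => ?_⟩, fun φ => (hs φ).hasSum⟩
  have h1 := tsum_of_norm_bounded
    ((summable_inv_latticeWeight_pow n).hasSum.mul_left (C * K * M)) (h C c hc φ M hM)
  refine h1.trans_eq ?_
  ring

lemma distCoeff_eq_of_hasFourierSeries (hr : ∀ i, 0 < r i) {c : (Fin n → ℤ) → ℂ}
    {W : PeriodicDistribution r} (h : HasFourierSeries c W) (k : Fin n → ℤ) :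
    distCoeff W k = c k := by
  have h1 : HasSum (fun j => c j * testCoeff j (character r (-k))) (W.1 (character r (-k))) :=
    h _
  have hprod : ((∏ i, r i : ℝ) : ℂ) ≠ 0 :=
    Complex.ofReal_ne_zero.2 (Finset.prod_pos fun i _ => hr i).ne'
  simp only [testCoeff_character hr, mul_ite, mul_zero] at h1
  have h2 : W.1 (character r (-k)) = c k * ((∏ i, r i : ℝ) : ℂ) := by
    refine h1.unique ?_
    convert hasSum_ite_eq k (c k * ((∏ i, r i : ℝ) : ℂ)) using 2 with j
    split_ifs with hj
    · rw [hj]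
    · rfl
  rw [distCoeff, h2, mul_comm (c k), inv_mul_cancel_left₀ hprod]

/-! ### Analysis: every distribution is the sum of its Fourier series -/

lemma mFourier_coe_eq_character (hr : ∀ i, 0 < r i) (k : Fin n → ℤ) (x : Fin n → ℝ) :
    UnitAddTorus.mFourier k (fun i => (x i : UnitAddCircle)) =
      (character r k).1 (WithLp.toLp 2 fun i => r i * x i) := by
  change ∏ i, fourier (k i) (x i : UnitAddCircle) = Complex.exp _
  simp only [fourier_coe_apply, ← Complex.exp_sum]
  congr 1
  simp only [PiLp.inner_apply, freq, Complex.ofReal_sum, Finset.mul_sum]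
  refine Finset.sum_congr rfl fun i _ => ?_
  have := Complex.ofReal_ne_zero.2 (hr i).ne'
  simp
  field_simp

lemma mFourierCoeff_eq_testCoeff (hr : ∀ i, 0 < r i) (φ : PeriodicTest r)
    (g : C(UnitAddTorus (Fin n), ℂ)) (hg : ∀ x : Fin n → ℝ,
      g (fun i => (x i : UnitAddCircle)) = φ.1 (WithLp.toLp 2 fun i => r i * x i))
    (k : Fin n → ℤ) :
    UnitAddTorus.mFourierCoeff g k = ((∏ i, r i : ℝ) : ℂ)⁻¹ * testCoeff (-k) φ := by
  have hprod : ((∏ i, r i : ℝ) : ℂ) ≠ 0 :=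
    Complex.ofReal_ne_zero.2 (Finset.prod_pos fun i _ => hr i).ne'
  rw [UnitAddTorus.mFourierCoeff_eq_integral g k 0, testCoeff, integral_cell_eq hr,
    inv_mul_cancel_left₀ hprod]
  simp only [mFourier_coe_eq_character hr, hg, smul_eq_mul, Pi.zero_apply]

lemma summable_latticeWeight_pow_mul_testCoeff (hr : ∀ i, 0 < r i) (φ : PeriodicTest r) (N : ℕ) :
    Summable fun k => latticeWeight k ^ N * ‖testCoeff (-k) φ‖ := by
  have h := summable_norm_mul_testCoeff hr (N := N) (C := 1)
    (c := fun k => ((latticeWeight k ^ N : ℝ) : ℂ))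
    (fun k => by
      have := latticeWeight_pos k
      rw [one_mul, Complex.norm_real, Real.norm_of_nonneg (by positivity)]) φ
  have h2 := (Equiv.neg (Fin n → ℤ)).summable_iff.2 h
  refine h2.congr fun k => ?_
  have := latticeWeight_pos k
  simp only [Function.comp, Equiv.neg_apply, latticeWeight_neg, norm_mul, Complex.norm_real]
  rw [Real.norm_of_nonneg (by positivity)]

lemma hasSum_testCoeff_mul_character (hr : ∀ i, 0 < r i) (φ : PeriodicTest r)
    (x : EuclideanSpace ℝ (Fin n)) :
    HasSum (fun k => ((∏ i, r i : ℝ) : ℂ)⁻¹ * testCoeff (-k) φ * (character r k).1 x)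
      (φ.1 x) := by
  obtain ⟨g, hg⟩ := exists_torus_lift (continuous_test φ) φ.2.2
  have hs : Summable (UnitAddTorus.mFourierCoeff g) := by
    simp only [funext (mFourierCoeff_eq_testCoeff hr φ g hg)]
    refine Summable.mul_left _ (Summable.of_norm ?_)
    simpa using summable_latticeWeight_pow_mul_testCoeff hr φ 0
  have h := UnitAddTorus.hasSum_mFourier_series_apply_of_summable hs
    fun i => ((x i / r i : ℝ) : UnitAddCircle)
  have hx : (WithLp.toLp 2 fun i => r i * (x i / r i)) = x := by
    ext i
    have := (hr i).ne'
    simp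
    field_simp
  have h2 := hg fun i => x i / r i
  rw [hx] at h2
  rw [h2] at h
  convert h using 2 with k
  rw [mFourierCoeff_eq_testCoeff hr φ g hg, mFourier_coe_eq_character hr, hx, smul_eq_mul]

lemma norm_iteratedFDeriv_character_le (k : Fin n → ℤ) (j : ℕ) (x : EuclideanSpace ℝ (Fin n)) :
    ‖iteratedFDeriv ℝ j (character r k).1 x‖ ≤ ‖freq r k‖ ^ j := by
  have hE : ContDiff ℝ ∞ fun t : ℝ => Complex.exp (Complex.I * (t : ℂ)) :=
    (contDiff_const.mul Complex.ofRealCLM.contDiff).cexp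
  have h1 : (character r k).1 =
      (fun t : ℝ => Complex.exp (Complex.I * (t : ℂ))) ∘ innerSL ℝ (freq r k) := rfl
  have h2 : ∀ (j : ℕ) (t : ℝ), iteratedDeriv j (fun t : ℝ => Complex.exp (Complex.I * (t : ℂ))) t =
      Complex.I ^ j * Complex.exp (Complex.I * (t : ℂ)) := by
    intro j
    induction j with
    | zero => simp
    | succ j ih =>
      intro t
      rw [iteratedDeriv_succ, funext ih]
      have h3 : HasDerivAt (fun t : ℝ => Complex.exp (Complex.I * (t : ℂ)))
          (Complex.exp (Complex.I * (t : ℂ)) * (Complex.I * 1)) t :=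
        ((Complex.ofRealCLM.hasDerivAt (x := t)).const_mul Complex.I).cexp
      rw [(h3.const_mul _).deriv]
      ring
  rw [h1, ContinuousLinearMap.iteratedFDeriv_comp_right _ hE x (by exact_mod_cast le_top)]
  refine (ContinuousMultilinearMap.norm_compContinuousLinearMap_le _ _).trans ?_
  rw [norm_iteratedFDeriv_eq_norm_iteratedDeriv, h2, norm_mul, norm_pow, Complex.norm_I, one_pow,
    mul_comm Complex.I, Complex.norm_exp_ofReal_mul_I]
  simp

lemma norm_freq_le (r : Fin n → ℝ) :
    ∃ B, 1 ≤ B ∧ ∀ k : Fin n → ℤ, ‖freq r k‖ ≤ B * latticeWeight k := by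
  refine ⟨1 + ∑ i, |2 * Real.pi / r i|, ?_, fun k => ?_⟩
  · exact le_add_of_nonneg_right (Finset.sum_nonneg fun _ _ => abs_nonneg _)
  · have hB : ∀ i, |2 * Real.pi / r i| ≤ 1 + ∑ i, |2 * Real.pi / r i| := fun i =>
      (Finset.single_le_sum (f := fun i => |2 * Real.pi / r i|) (fun _ _ => abs_nonneg _)
        (Finset.mem_univ i)).trans (by simp)
    set B := 1 + ∑ i, |2 * Real.pi / r i| with hBdef
    have hB0 : 0 ≤ B := add_nonneg zero_le_one (Finset.sum_nonneg fun _ _ => abs_nonneg _)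
    have hw := one_le_latticeWeight k
    refine le_of_sq_le_sq ?_ (by positivity)
    rw [EuclideanSpace.norm_sq_eq, mul_pow]
    calc ∑ i, ‖freq r k i‖ ^ 2 ≤ ∑ i, B ^ 2 * (k i : ℝ) ^ 2 := by
          refine Finset.sum_le_sum fun i _ => ?_
          have : freq r k i = 2 * Real.pi / r i * k i := by simp [freq]; ring
          rw [this, norm_mul, mul_pow, Real.norm_eq_abs, Real.norm_eq_abs, sq_abs (k i : ℝ)]
          gcongr
          exact hB i
      _ = B ^ 2 * ∑ i, (k i : ℝ) ^ 2 := by rw [Finset.mul_sum]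
      _ ≤ B ^ 2 * latticeWeight k ^ 2 := by
          gcongr
          have : ∑ i, (k i : ℝ) ^ 2 ≤ latticeWeight k := by simp [latticeWeight]
          nlinarith

lemma norm_iteratedFDeriv_tsum_le {ι E F : Type*} [NormedAddCommGroup E] [NormedSpace ℝ E]
    [NormedAddCommGroup F] [NormedSpace ℝ F] [CompleteSpace F] {f : ι → E → F} {v : ι → ℝ} {m : ℕ}
    (hf : ∀ i, ContDiff ℝ m (f i)) (hv : Summable v)
    (h : ∀ j ≤ m, ∀ i x, ‖iteratedFDeriv ℝ j (f i) x‖ ≤ v i) {j : ℕ} (hj : j ≤ m) (x : E) :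
    ‖iteratedFDeriv ℝ j (fun y => ∑' i, f i y) x‖ ≤ ∑' i, v i := by
  rw [iteratedFDeriv_tsum (N := m) (v := fun _ => v) hf (fun _ _ => hv)
    (fun j i x hj => h j (by exact_mod_cast hj) i x) (by exact_mod_cast hj)]
  exact tsum_of_norm_bounded hv.hasSum fun i => h j hj i x

lemma hasFourierSeries_distCoeff (hr : ∀ i, 0 < r i) (W : PeriodicDistribution r) :
    HasFourierSeries (distCoeff W) W := by
  intro φ
  change HasSum (fun k => distCoeff W k * testCoeff k φ) _
  obtain ⟨C, m, hW⟩ := W.2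
  obtain ⟨B, hB1, hB⟩ := norm_freq_le r
  -- These are the Fourier coefficients of `φ`; the index is negated because `testCoeff` pairs with
  -- `e^{+i ν_k · x}`.
  set a : (Fin n → ℤ) → ℂ := fun k => ((∏ i, r i : ℝ) : ℂ)⁻¹ * testCoeff (-k) φ with ha
  have hpt : ∀ x, HasSum (fun k => a k * (character r k).1 x) (φ.1 x) :=
    hasSum_testCoeff_mul_character hr φ
  have hu : Summable fun k => ‖a k‖ * (B * latticeWeight k) ^ m := by
    refine ((summable_latticeWeight_pow_mul_testCoeff hr φ m).mul_left
      (‖((∏ i, r i : ℝ) : ℂ)⁻¹‖ * B ^ m)).congr fun k => ?_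
    rw [ha, norm_mul, mul_pow]
    ring
  -- The error of a partial sum is `W` applied to the tail of the Fourier series of `φ`, and the
  -- `C^m` norm of that tail is controlled by the tail of a convergent series.
  have key : ∀ S : Finset (Fin n → ℤ), ‖W.1 φ - ∑ k ∈ S, a k * W.1 (character r k)‖ ≤
      C * ∑' k : {k // k ∉ S}, ‖a k‖ * (B * latticeWeight k.1) ^ m := by
    intro S
    have h1 : W.1 φ - ∑ k ∈ S, a k * W.1 (character r k) =
        W.1 (φ - ∑ k ∈ S, a k • character r k) := by
      simp [map_sum]
    rw [h1]
    refine hW _ _ fun j hj x => ?_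
    have h2 : ((φ - ∑ k ∈ S, a k • character r k : PeriodicTest r) :
        EuclideanSpace ℝ (Fin n) → ℂ) =
          fun x => ∑' k : {k // k ∉ S}, (a k • character r k.1 : PeriodicTest r).1 x := by
      ext x
      have h3 := (hpt x).summable.sum_add_tsum_subtype_compl S
      rw [(hpt x).tsum_eq] at h3
      simp only [Submodule.coe_sub, Submodule.coe_sum, Submodule.coe_smul, Pi.sub_apply,
        Finset.sum_apply, Pi.smul_apply, smul_eq_mul]
      rw [← h3]
      ring
    have hbd : ∀ i ≤ m, ∀ (k : {k // k ∉ S}) (x : EuclideanSpace ℝ (Fin n)),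
        ‖iteratedFDeriv ℝ i (a k • character r k.1 : PeriodicTest r).1 x‖ ≤
          ‖a k‖ * (B * latticeWeight k.1) ^ m := by
      intro i hi k x
      have h4 : (a k • character r k.1 : PeriodicTest r).1 = a k • (character r k.1).1 := rfl
      have hw := one_le_latticeWeight k.1
      have h5 : 1 ≤ B * latticeWeight k.1 := by nlinarith
      rw [h4, iteratedFDeriv_const_smul_apply
        ((contDiff_test _).contDiffAt.of_le (by exact_mod_cast le_top)), norm_smul]
      gcongr
      refine (norm_iteratedFDeriv_character_le _ _ _).trans ?_
      exact (pow_le_pow_left₀ (norm_nonneg _) (hB _) _).trans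
        (pow_le_pow_right₀ h5 hi)
    have hs : Summable fun k : {k // k ∉ S} => ‖a k‖ * (B * latticeWeight k.1) ^ m :=
      hu.subtype _
    rw [h2]
    exact norm_iteratedFDeriv_tsum_le
      (fun k => (contDiff_test _).of_le (by exact_mod_cast le_top)) hs hbd hj x
  have hlim : Tendsto (fun S : Finset (Fin n → ℤ) => ∑ k ∈ S, a k * W.1 (character r k)) atTop
      (𝓝 (W.1 φ)) := by
    rw [tendsto_iff_norm_sub_tendsto_zero]
    have h0 := (tendsto_tsum_compl_atTop_zero
      fun k => ‖a k‖ * (B * latticeWeight k) ^ m).const_mul C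
    rw [mul_zero] at h0
    refine squeeze_zero (fun _ => norm_nonneg _) (fun S => ?_) h0
    rw [norm_sub_rev]
    exact key S
  have h6 : HasSum (fun k => a k * W.1 (character r k)) (W.1 φ) := hlim
  have h7 := (Equiv.neg (Fin n → ℤ)).hasSum_iff.2 h6
  convert h7 using 1
  ext k
  simp [ha, distCoeff]
  ring

lemma distribution_ext (hr : ∀ i, 0 < r i) {V W : PeriodicDistribution r}
    (h : ∀ k, distCoeff V k = distCoeff W k) : V = W := by
  refine Subtype.ext (LinearMap.ext fun φ => ?_)
  have h1 := hasFourierSeries_distCoeff hr V φ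
  rw [funext h] at h1
  exact h1.unique (hasFourierSeries_distCoeff hr W φ)

end NonlocalDiffusion

namespace NonlocalDiffusion

/-! ### The symbol integral -/

/-- The positive integral `∫_{B_δ(0)} (1 - cos (ν · z)) / ‖z‖^β dz`. -/
def symbolIntegral {n : ℕ} (δ β : ℝ) (ν : EuclideanSpace ℝ (Fin n)) : ℝ :=
  ∫ z in Metric.ball (0 : EuclideanSpace ℝ (Fin n)) δ, (1 - Real.cos (inner ℝ ν z)) / ‖z‖ ^ β

section SymbolIntegral

variable {n : ℕ} {δ β : ℝ}

lemma symbolIntegrand_nonneg (β : ℝ) (ν z : EuclideanSpace ℝ (Fin n)) :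
    0 ≤ (1 - Real.cos (inner ℝ ν z)) / ‖z‖ ^ β :=
  div_nonneg (sub_nonneg.2 (Real.cos_le_one _)) (Real.rpow_nonneg (norm_nonneg _) _)

lemma symbolIntegral_nonneg (δ β : ℝ) (ν : EuclideanSpace ℝ (Fin n)) :
    0 ≤ symbolIntegral δ β ν :=
  setIntegral_nonneg measurableSet_ball fun z _ => symbolIntegrand_nonneg β ν z

lemma integrableOn_norm_rpow_ball (hn : 1 ≤ n) (hδ : 0 < δ) {p : ℝ} (hp : -(n : ℝ) < p) :
    IntegrableOn (fun z : EuclideanSpace ℝ (Fin n) => ‖z‖ ^ p) (Metric.ball 0 δ) := by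
  have : Nonempty (Fin n) := ⟨⟨0, hn⟩⟩
  rw [integrableOn_fun_norm_addHaar volume (f := fun y : ℝ => y ^ p)]
  have h1 : IntegrableOn (fun y : ℝ => y ^ ((n : ℝ) - 1 + p)) (Set.Ioo 0 δ) :=
    (intervalIntegral.integrableOn_Ioo_rpow_iff hδ).2 (by linarith)
  refine h1.congr_fun (fun y hy => ?_) measurableSet_Ioo
  have h2 : ((n - 1 : ℕ) : ℝ) = (n : ℝ) - 1 := by push_cast [hn]; ring
  simp only [finrank_euclideanSpace, Fintype.card_fin, smul_eq_mul]
  rw [Real.rpow_add hy.1, ← Real.rpow_natCast, h2]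

lemma measurable_symbolIntegrand (β : ℝ) (ν : EuclideanSpace ℝ (Fin n)) :
    Measurable fun z : EuclideanSpace ℝ (Fin n) =>
      (1 - Real.cos (inner ℝ ν z)) / ‖z‖ ^ β := by
  have h1 : Measurable fun z : EuclideanSpace ℝ (Fin n) => 1 - Real.cos (inner ℝ ν z) := by
    have : Continuous fun z : EuclideanSpace ℝ (Fin n) => 1 - Real.cos (inner ℝ ν z) := by fun_prop
    exact this.measurable
  exact h1.div (measurable_norm.pow_const β)

/-- From `1 - cos x ≤ x²/2`. The numerator cancels two orders of the singularity, which is why `β <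
n + 2` suffices for integrability. -/
lemma symbolIntegrand_le (β : ℝ) (ν : EuclideanSpace ℝ (Fin n)) {z : EuclideanSpace ℝ (Fin n)} :
    (1 - Real.cos (inner ℝ ν z)) / ‖z‖ ^ β ≤ ‖ν‖ ^ 2 / 2 * ‖z‖ ^ (2 - β) := by
  rcases eq_or_ne z 0 with rfl | hz
  · simp
    positivity
  · have hz : 0 < ‖z‖ := norm_pos_iff.2 hz
    rw [Real.rpow_sub hz, ← mul_div_assoc]
    gcongr
    have h1 := Real.one_sub_sq_div_two_le_cos (x := inner ℝ ν z)
    have h2 : (inner ℝ ν z) ^ 2 ≤ (‖ν‖ * ‖z‖) ^ 2 := by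
      rw [← sq_abs]
      exact pow_le_pow_left₀ (abs_nonneg _) (abs_real_inner_le_norm ν z) 2
    rw [mul_pow] at h2
    norm_cast
    linarith

lemma integrableOn_symbolIntegrand (hn : 1 ≤ n) (hδ : 0 < δ) (hβ : β < n + 2)
    (ν : EuclideanSpace ℝ (Fin n)) :
    IntegrableOn (fun z => (1 - Real.cos (inner ℝ ν z)) / ‖z‖ ^ β)
      (Metric.ball (0 : EuclideanSpace ℝ (Fin n)) δ) := by
  refine Integrable.mono' ((integrableOn_norm_rpow_ball hn hδ (p := 2 - β)
    (by linarith)).const_mul (‖ν‖ ^ 2 / 2))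
    (measurable_symbolIntegrand β ν).aestronglyMeasurable (Eventually.of_forall fun z => ?_)
  rw [Real.norm_of_nonneg (symbolIntegrand_nonneg β ν z)]
  exact symbolIntegrand_le β ν

lemma symbolIntegral_le (hn : 1 ≤ n) (hδ : 0 < δ) (hβ : β < n + 2) :
    ∃ C, 0 ≤ C ∧ ∀ ν : EuclideanSpace ℝ (Fin n), symbolIntegral δ β ν ≤ C * ‖ν‖ ^ 2 := by
  have hi := integrableOn_norm_rpow_ball hn hδ (p := 2 - β) (by linarith)
  refine ⟨(∫ z in Metric.ball (0 : EuclideanSpace ℝ (Fin n)) δ, ‖z‖ ^ (2 - β)) / 2,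
    div_nonneg (setIntegral_nonneg measurableSet_ball fun z _ =>
      Real.rpow_nonneg (norm_nonneg _) _) zero_le_two, fun ν => ?_⟩
  calc symbolIntegral δ β ν
      ≤ ∫ z in Metric.ball (0 : EuclideanSpace ℝ (Fin n)) δ, ‖ν‖ ^ 2 / 2 * ‖z‖ ^ (2 - β) :=
        integral_mono (integrableOn_symbolIntegrand hn hδ hβ ν) (hi.const_mul _)
          fun z => symbolIntegrand_le β ν
    _ = _ := by rw [integral_const_mul]; ring

/-- The half-open annulus `δ/2 ≤ ‖z‖ < δ`. -/
def annulus (n : ℕ) (δ : ℝ) : Set (EuclideanSpace ℝ (Fin n)) :=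
  Metric.ball 0 δ \ Metric.ball 0 (δ / 2)

lemma measurableSet_annulus : MeasurableSet (annulus n δ) :=
  measurableSet_ball.diff measurableSet_ball

open scoped Pointwise in
-- Scale invariance of `‖z‖^{-n} dz`: the substitution `z ↦ z/2` identifies the part over the ball
-- of radius `δ/2` with the full integral at frequency `ν/2`.
lemma symbolIntegral_eq_half_add (hn : 1 ≤ n) (hδ : 0 < δ) (ν : EuclideanSpace ℝ (Fin n)) :
    symbolIntegral δ n ν = symbolIntegral δ n ((1 / 2 : ℝ) • ν) +
      ∫ z in annulus n δ, (1 - Real.cos (inner ℝ ν z)) / ‖z‖ ^ (n : ℝ) := by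
  have hint := integrableOn_symbolIntegrand hn hδ (β := n) (by linarith) ν
  have hsub : Metric.ball (0 : EuclideanSpace ℝ (Fin n)) (δ / 2) ⊆ Metric.ball 0 δ :=
    Metric.ball_subset_ball (by linarith)
  have h1 : (∫ z in annulus n δ, (1 - Real.cos (inner ℝ ν z)) / ‖z‖ ^ (n : ℝ)) +
      ∫ z in Metric.ball 0 (δ / 2), (1 - Real.cos (inner ℝ ν z)) / ‖z‖ ^ (n : ℝ) =
        symbolIntegral δ n ν := by
    rw [annulus, setIntegral_sdiff measurableSet_ball hint hsub, sub_add_cancel, symbolIntegral]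
  have h2 := Measure.setIntegral_comp_smul_of_pos (volume : Measure (EuclideanSpace ℝ (Fin n)))
    (fun z => (1 - Real.cos (inner ℝ ν z)) / ‖z‖ ^ (n : ℝ)) (R := 1 / 2)
    (Metric.ball (0 : EuclideanSpace ℝ (Fin n)) δ) (by norm_num)
  have h3 : (1 / 2 : ℝ) • Metric.ball (0 : EuclideanSpace ℝ (Fin n)) δ =
      Metric.ball 0 (δ / 2) := by
    rw [smul_ball (by norm_num), smul_zero, Real.norm_of_nonneg (by norm_num)]
    congr 1
    ring
  have h4 : ∀ z : EuclideanSpace ℝ (Fin n),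
      (1 - Real.cos (inner ℝ ν ((1 / 2 : ℝ) • z))) / ‖(1 / 2 : ℝ) • z‖ ^ (n : ℝ) =
        2 ^ n * ((1 - Real.cos (inner ℝ ((1 / 2 : ℝ) • ν) z)) / ‖z‖ ^ (n : ℝ)) := by
    intro z
    rw [inner_smul_right, inner_smul_left, norm_smul, Real.mul_rpow (norm_nonneg _) (norm_nonneg _)]
    simp
    field_simp
  simp only [h3, h4, integral_const_mul, finrank_euclideanSpace, Fintype.card_fin, smul_eq_mul]
    at h2
  rw [← h1, add_comm]
  congr 1
  have h5 : ((1 / 2 : ℝ) ^ n)⁻¹ = 2 ^ n := by simp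
  rw [h5] at h2
  exact (mul_left_cancel₀ (by positivity) h2).symm

lemma integrableOn_annulus_rpow (hn : 1 ≤ n) (hδ : 0 < δ) :
    IntegrableOn (fun z : EuclideanSpace ℝ (Fin n) => (‖z‖ ^ (n : ℝ))⁻¹) (annulus n δ) := by
  refine Measure.integrableOn_of_bounded (M := ((δ / 2) ^ (n : ℝ))⁻¹) ?_ ?_ ?_
  · exact ((measure_mono Set.sdiff_subset).trans_lt measure_ball_lt_top).ne
  · exact (measurable_norm.pow_const _).inv.aestronglyMeasurable
  · refine (ae_restrict_iff' measurableSet_annulus).2 (Eventually.of_forall fun z hz => ?_)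
    have h1 : δ / 2 ≤ ‖z‖ := by simpa using hz.2
    rw [Real.norm_of_nonneg (by positivity)]
    gcongr

lemma integral_annulus_rpow (hn : 1 ≤ n) (hδ : 0 < δ) :
    ∫ z in annulus n δ, (‖z‖ ^ (n : ℝ))⁻¹ =
      n * volume.real (Metric.ball (0 : EuclideanSpace ℝ (Fin n)) 1) * Real.log 2 := by
  have : Nonempty (Fin n) := ⟨⟨0, hn⟩⟩
  have h := integral_fun_norm_addHaar (volume : Measure (EuclideanSpace ℝ (Fin n)))
    ((Set.Ico (δ / 2) δ).indicator fun y => (y ^ (n : ℝ))⁻¹)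
  have h1 : (fun z : EuclideanSpace ℝ (Fin n) =>
      (Set.Ico (δ / 2) δ).indicator (fun y => (y ^ (n : ℝ))⁻¹) ‖z‖) =
        (annulus n δ).indicator fun z => (‖z‖ ^ (n : ℝ))⁻¹ := by
    ext z
    by_cases hz : z ∈ annulus n δ
    · have hz' : ‖z‖ ∈ Set.Ico (δ / 2) δ := by simpa [annulus, and_comm] using hz
      rw [Set.indicator_of_mem hz, Set.indicator_of_mem hz']
    · have hz' : ‖z‖ ∉ Set.Ico (δ / 2) δ := by simpa [annulus, and_comm] using hz
      rw [Set.indicator_of_notMem hz, Set.indicator_of_notMem hz']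
  rw [h1, integral_indicator measurableSet_annulus] at h
  rw [h]
  have h2 : ∫ y in Set.Ioi (0 : ℝ), y ^ (Module.finrank ℝ (EuclideanSpace ℝ (Fin n)) - 1) •
      (Set.Ico (δ / 2) δ).indicator (fun y => (y ^ (n : ℝ))⁻¹) y = Real.log 2 := by
    have h3 : ∀ y : ℝ, y ^ (Module.finrank ℝ (EuclideanSpace ℝ (Fin n)) - 1) •
        (Set.Ico (δ / 2) δ).indicator (fun y => (y ^ (n : ℝ))⁻¹) y =
          (Set.Ico (δ / 2) δ).indicator (fun y => y⁻¹) y := by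
      intro y
      by_cases hy : y ∈ Set.Ico (δ / 2) δ
      · have hy0 : 0 < y := by linarith [hy.1]
        rw [Set.indicator_of_mem hy, Set.indicator_of_mem hy, finrank_euclideanSpace,
          Fintype.card_fin, Real.rpow_natCast, smul_eq_mul]
        obtain ⟨m, rfl⟩ := Nat.exists_eq_add_of_le' hn
        simp only [Nat.add_sub_cancel]
        field_simp
        ring
      · rw [Set.indicator_of_notMem hy, Set.indicator_of_notMem hy, smul_zero]
    simp only [h3]
    rw [setIntegral_indicator measurableSet_Ico]
    have h4 : Set.Ioi (0 : ℝ) ∩ Set.Ico (δ / 2) δ = Set.Ico (δ / 2) δ :=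
      Set.inter_eq_right.2 fun y hy => by
        have := hy.1
        exact lt_of_lt_of_le (by linarith) this
    rw [h4, integral_Ico_eq_integral_Ioc, ← intervalIntegral.integral_of_le (by linarith),
      integral_inv_of_pos (by linarith) hδ]
    congr 1
    field_simp
  rw [h2, finrank_euclideanSpace, Fintype.card_fin]
  simp [mul_assoc]

/-- The Riemann–Lebesgue lemma, since the weight is integrable over the annulus. -/
lemma tendsto_integral_annulus_cos (hn : 1 ≤ n) (hδ : 0 < δ) :
    Tendsto (fun ν : EuclideanSpace ℝ (Fin n) =>
      ∫ z in annulus n δ, Real.cos (inner ℝ ν z) / ‖z‖ ^ (n : ℝ)) (cocompact _) (𝓝 0) := by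
  let f : EuclideanSpace ℝ (Fin n) → ℂ :=
    (annulus n δ).indicator fun z => (((‖z‖ ^ (n : ℝ))⁻¹ : ℝ) : ℂ)
  have hf : Integrable f :=
    (integrable_indicator_iff measurableSet_annulus).2 (integrableOn_annulus_rpow hn hδ).ofReal
  have h := tendsto_integral_exp_inner_smul_cocompact f
  -- The frequency is rescaled because `Real.fourierChar` contains the factor `2π`.
  have hscale : Tendsto (fun ν : EuclideanSpace ℝ (Fin n) => (2 * Real.pi)⁻¹ • ν)
      (cocompact _) (cocompact _) :=
    (Homeomorph.smulOfNeZero (2 * Real.pi)⁻¹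
      (inv_ne_zero Real.two_pi_pos.ne')).isClosedEmbedding.tendsto_cocompact
  have h2 := (Complex.continuous_re.tendsto 0).comp (h.comp hscale)
  rw [Complex.zero_re] at h2
  refine h2.congr fun ν => ?_
  have hi : Integrable fun v => Real.fourierChar (-(inner ℝ v ((2 * Real.pi)⁻¹ • ν))) • f v :=
    (Real.fourierIntegral_convergent_iff _).2 hf
  simp only [Function.comp_apply]
  rw [← integral_indicator measurableSet_annulus]
  have h3 := (Complex.reCLM.integral_comp_comm hi).symm
  simp only [Complex.reCLM_apply] at h3
  rw [h3]
  refine integral_congr_ae (Eventually.of_forall fun z => ?_)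
  by_cases hz : z ∈ annulus n δ
  · simp only [f, Set.indicator_of_mem hz]
    rw [Circle.smul_def, Real.fourierChar_apply, smul_eq_mul, Complex.re_mul_ofReal,
      Complex.exp_ofReal_mul_I_re, inner_smul_right, real_inner_comm, div_eq_mul_inv]
    congr 1
    rw [← Real.cos_neg]
    congr 1
    have := Real.pi_ne_zero
    field_simp
  · simp only [f, Set.indicator_of_notMem hz]
    simp

/-- Halve `ν` until its norm is at most `R`. Each halving from `‖ν‖ ≥ R` contributes an annulus
integral of at least `(L - η) log 2`, where `L` is the area of the unit sphere, and about `log₂ (‖ν‖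
/ R)` halvings are needed. -/
lemma le_symbolIntegral_natCast (hn : 1 ≤ n) (hδ : 0 < δ) {η : ℝ} (hη : 0 < η)
    (hη' : η ≤ n * volume.real (Metric.ball (0 : EuclideanSpace ℝ (Fin n)) 1)) :
    ∃ R, 1 ≤ R ∧ ∀ ν : EuclideanSpace ℝ (Fin n),
      (n * volume.real (Metric.ball (0 : EuclideanSpace ℝ (Fin n)) 1) - η) *
        (Real.log ‖ν‖ - Real.log R) ≤ symbolIntegral δ n ν := by
  set L := n * volume.real (Metric.ball (0 : EuclideanSpace ℝ (Fin n)) 1) with hL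
  have hlog2 : 0 < Real.log 2 := Real.log_pos one_lt_two
  have hev : ∀ᶠ ν : EuclideanSpace ℝ (Fin n) in cocompact _,
      ∫ z in annulus n δ, Real.cos (inner ℝ ν z) / ‖z‖ ^ (n : ℝ) < η * Real.log 2 :=
    (tendsto_integral_annulus_cos hn hδ).eventually (gt_mem_nhds (by positivity))
  rw [← Metric.cobounded_eq_cocompact, (hasBasis_cobounded_norm).eventually_iff] at hev
  obtain ⟨R₀, -, hR₀⟩ := hev
  have hannulus : ∀ ν : EuclideanSpace ℝ (Fin n), R₀ ≤ ‖ν‖ → (L - η) * Real.log 2 ≤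
      ∫ z in annulus n δ, (1 - Real.cos (inner ℝ ν z)) / ‖z‖ ^ (n : ℝ) := by
    intro ν hν
    have hi := integrableOn_annulus_rpow hn hδ
    have hi2 : IntegrableOn (fun z : EuclideanSpace ℝ (Fin n) =>
        Real.cos (inner ℝ ν z) / ‖z‖ ^ (n : ℝ)) (annulus n δ) := by
      refine Integrable.mono' hi ?_ (Eventually.of_forall fun z => ?_)
      · have : Continuous fun z : EuclideanSpace ℝ (Fin n) => Real.cos (inner ℝ ν z) := by fun_prop
        exact (this.measurable.div (measurable_norm.pow_const _)).aestronglyMeasurable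
      · rw [norm_div, Real.norm_of_nonneg (Real.rpow_nonneg (norm_nonneg _) _), div_eq_mul_inv]
        exact mul_le_of_le_one_left (inv_nonneg.2 (Real.rpow_nonneg (norm_nonneg _) _))
          (Real.abs_cos_le_one _)
    have h1 : ∀ z : EuclideanSpace ℝ (Fin n), (1 - Real.cos (inner ℝ ν z)) / ‖z‖ ^ (n : ℝ) =
        (‖z‖ ^ (n : ℝ))⁻¹ - Real.cos (inner ℝ ν z) / ‖z‖ ^ (n : ℝ) := fun z => by
      rw [sub_div, one_div]
    simp only [h1]
    rw [integral_sub hi hi2, integral_annulus_rpow hn hδ, ← hL]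
    linarith [(hR₀ (x := ν) hν).le]
  refine ⟨max R₀ 1, le_max_right _ _, fun ν => ?_⟩
  set R := max R₀ 1
  have hR1 : 1 ≤ R := le_max_right _ _
  have key : ∀ (j : ℕ) (ν : EuclideanSpace ℝ (Fin n)), ‖ν‖ ≤ 2 ^ j * R →
      (L - η) * (Real.log ‖ν‖ - Real.log R) ≤ symbolIntegral δ n ν := by
    have hsmall : ∀ ν : EuclideanSpace ℝ (Fin n), ‖ν‖ ≤ R →
        (L - η) * (Real.log ‖ν‖ - Real.log R) ≤ symbolIntegral δ n ν := by
      intro ν hν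
      refine le_trans ?_ (symbolIntegral_nonneg _ _ _)
      refine mul_nonpos_of_nonneg_of_nonpos (sub_nonneg.2 hη') (sub_nonpos.2 ?_)
      -- At `ν = 0` the value `Real.log 0 = 0` is harmless because `R ≥ 1`.
      rcases (norm_nonneg ν).eq_or_lt with h0 | h0
      · rw [← h0, Real.log_zero]
        exact Real.log_nonneg hR1
      · exact Real.log_le_log h0 hν
    intro j
    induction j with
    | zero => simpa using hsmall
    | succ j ih =>
      intro ν hν
      rcases le_total ‖ν‖ R with h | h
      · exact hsmall ν h
      · have hν0 : 0 < ‖ν‖ := by linarith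
        have hhalf : ‖(1 / 2 : ℝ) • ν‖ = ‖ν‖ / 2 := by
          rw [norm_smul]
          norm_num
          ring
        have h1 := ih ((1 / 2 : ℝ) • ν) (by rw [hhalf]; rw [pow_succ] at hν; linarith)
        rw [hhalf, Real.log_div hν0.ne' two_ne_zero] at h1
        rw [symbolIntegral_eq_half_add hn hδ]
        have h2 := hannulus ν ((le_max_left _ _).trans h)
        linarith
  obtain ⟨j, hj⟩ := pow_unbounded_of_one_lt ‖ν‖ one_lt_two
  refine key j ν (hj.le.trans ?_)
  exact le_mul_of_one_le_right (by positivity) hR1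

lemma volume_real_ball_one (hn : 1 ≤ n) :
    volume.real (Metric.ball (0 : EuclideanSpace ℝ (Fin n)) 1) =
      Real.pi ^ ((n : ℝ) / 2) / Real.Gamma ((n : ℝ) / 2 + 1) := by
  have : Nonempty (Fin n) := ⟨⟨0, hn⟩⟩
  have h1 : √Real.pi ^ n = Real.pi ^ ((n : ℝ) / 2) := by
    rw [Real.sqrt_eq_rpow, ← Real.rpow_natCast, ← Real.rpow_mul Real.pi_pos.le]
    ring_nf
  have h2 : 0 < Real.Gamma ((n : ℝ) / 2 + 1) := Real.Gamma_pos_of_pos (by positivity)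
  rw [Measure.real, EuclideanSpace.volume_ball]
  simp only [Fintype.card_fin, ENNReal.ofReal_one, one_pow, one_mul, h1]
  exact ENNReal.toReal_ofReal (by positivity)

/-! ### The multipliers for `β < n + 2` -/

lemma scalingConst_pos (hδ : 0 < δ) (hβ : β < n + 2) : 0 < scalingConst n δ β := by
  have h2 : 0 < Real.Gamma ((n : ℝ) / 2 + 1) := Real.Gamma_pos_of_pos (by positivity)
  have h3 : 0 < (n : ℝ) + 2 - β := by linarith
  rw [scalingConst]
  positivity

lemma multiplier_eq_symbolIntegral (hβ : β < n + 2) (ν : EuclideanSpace ℝ (Fin n)) :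
    multiplier δ β ν = -(scalingConst n δ β * symbolIntegral δ β ν) := by
  rw [multiplier, if_pos hβ, symbolIntegral, ← mul_neg, ← integral_neg]
  congr 2
  ext z
  ring

/-- The source of the rate `4n/δ²`: it is the scaling constant times the area of the unit sphere. -/
lemma scalingConst_natCast_mul (hn : 1 ≤ n) (hδ : 0 < δ) :
    scalingConst n δ n * (n * volume.real (Metric.ball (0 : EuclideanSpace ℝ (Fin n)) 1)) =
      4 * n / δ ^ 2 := by
  have h2 : 0 < Real.Gamma ((n : ℝ) / 2 + 1) := Real.Gamma_pos_of_pos (by positivity)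
  have h3 : (n : ℝ) + 2 - n = 2 := by ring
  have h4 : 0 < Real.pi ^ ((n : ℝ) / 2) := by positivity
  rw [volume_real_ball_one hn, scalingConst, h3, Real.rpow_two]
  field_simp
  ring

lemma multiplier_natCast_le (hn : 1 ≤ n) (hδ : 0 < δ) {σ : ℝ} (hσ : 0 ≤ σ)
    (hσ' : σ < 4 * n / δ ^ 2) :
    ∃ C, ∀ ν : EuclideanSpace ℝ (Fin n), multiplier δ n ν ≤ C - σ * Real.log ‖ν‖ := by
  have hc := scalingConst_pos (n := n) (β := n) hδ (by linarith)
  set c := scalingConst n δ n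
  have hcL := scalingConst_natCast_mul hn hδ
  set L := n * volume.real (Metric.ball (0 : EuclideanSpace ℝ (Fin n)) 1) with hL
  -- This loss `η` makes the slope `c (L - η)` exactly `σ`.
  have hη : 0 < L - σ / c := by
    rw [sub_pos, div_lt_iff₀ hc]
    linarith
  obtain ⟨R, -, hR⟩ := le_symbolIntegral_natCast hn hδ hη (by
    have : 0 ≤ σ / c := by positivity
    linarith)
  refine ⟨σ * Real.log R, fun ν => ?_⟩
  have h := mul_le_mul_of_nonneg_left (hR ν) hc.le
  rw [multiplier_eq_symbolIntegral (by linarith)]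
  have h2 : c * ((L - (L - σ / c)) * (Real.log ‖ν‖ - Real.log R)) =
      σ * (Real.log ‖ν‖ - Real.log R) := by
    field_simp
    ring
  rw [← hL, h2] at h
  linarith

/-- On the ball of radius `η` one has `‖z‖^{-β} ≥ η^{n-β} ‖z‖^{-n}`, and the integrand outside it is
nonnegative. -/
lemma rpow_mul_symbolIntegral_le (hn : 1 ≤ n) {η : ℝ} (hη : 0 < η) (hηδ : η ≤ δ)
    (hβn : n ≤ β) (hβ : β < n + 2) (ν : EuclideanSpace ℝ (Fin n)) :
    η ^ (n - β) * symbolIntegral η n ν ≤ symbolIntegral δ β ν := by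
  have hi := integrableOn_symbolIntegrand hn (hη.trans_le hηδ) hβ ν
  have hsub : Metric.ball (0 : EuclideanSpace ℝ (Fin n)) η ⊆ Metric.ball 0 δ :=
    Metric.ball_subset_ball hηδ
  calc η ^ (n - β) * symbolIntegral η n ν
      = ∫ z in Metric.ball (0 : EuclideanSpace ℝ (Fin n)) η,
          η ^ (n - β) * ((1 - Real.cos (inner ℝ ν z)) / ‖z‖ ^ (n : ℝ)) := by
        rw [symbolIntegral, integral_const_mul]
    _ ≤ ∫ z in Metric.ball (0 : EuclideanSpace ℝ (Fin n)) η,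
          (1 - Real.cos (inner ℝ ν z)) / ‖z‖ ^ β := by
        refine setIntegral_mono_on ((integrableOn_symbolIntegrand hn hη
          (by linarith) ν).const_mul _) (hi.mono_set hsub) measurableSet_ball fun z hz => ?_
        rcases eq_or_ne z 0 with rfl | hz0
        · simp
        · have hz0 : 0 < ‖z‖ := norm_pos_iff.2 hz0
          have hz : ‖z‖ < η := by simpa using hz
          have h1 : η ^ (n - β) ≤ ‖z‖ ^ (n - β) :=
            Real.rpow_le_rpow_of_nonpos hz0 hz.le (by linarith)
          calc η ^ (n - β) * ((1 - Real.cos (inner ℝ ν z)) / ‖z‖ ^ (n : ℝ))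
              ≤ ‖z‖ ^ (n - β) * ((1 - Real.cos (inner ℝ ν z)) / ‖z‖ ^ (n : ℝ)) :=
                mul_le_mul_of_nonneg_right h1 (symbolIntegrand_nonneg _ _ _)
            _ = _ := by
              rw [Real.rpow_sub hz0]
              have := (Real.rpow_pos_of_pos hz0 n).ne'
              field_simp
    _ ≤ symbolIntegral δ β ν :=
        setIntegral_mono_set hi (Eventually.of_forall fun z => symbolIntegrand_nonneg β ν z)
          hsub.eventuallyLE

lemma multiplier_le_of_natCast_lt (hn : 1 ≤ n) (hδ : 0 < δ) (hβn : n < β) (hβ : β < n + 2)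
    {σ : ℝ} (hσ : 0 ≤ σ) :
    ∃ C, ∀ ν : EuclideanSpace ℝ (Fin n), multiplier δ β ν ≤ C - σ * Real.log ‖ν‖ := by
  have hc := scalingConst_pos (n := n) (β := β) hδ hβ
  set c := scalingConst n δ β
  set L := n * volume.real (Metric.ball (0 : EuclideanSpace ℝ (Fin n)) 1) with hL
  have hL0 : 0 < L := by
    have : 0 < volume.real (Metric.ball (0 : EuclideanSpace ℝ (Fin n)) 1) := by
      have := Real.Gamma_pos_of_pos (s := (n : ℝ) / 2 + 1) (by positivity)
      rw [volume_real_ball_one hn]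
      positivity
    positivity
  -- As `n - β < 0`, the factor `η^{n-β}` is arbitrarily large for small `η`. The `2` compensates
  -- for using only half of the slope `L` below.
  obtain ⟨η, hη, hηδ, hηL⟩ : ∃ η, 0 < η ∧ η ≤ δ ∧ 2 * σ / (c * L) ≤ η ^ (n - β) := by
    have h1 := tendsto_rpow_neg_nhdsGT_zero (y := n - β) (by linarith)
    have h2 := (h1.eventually_ge_atTop (2 * σ / (c * L))).and
      (Ioc_mem_nhdsGT hδ)
    obtain ⟨η, h3, h4⟩ := h2.exists
    exact ⟨η, h4.1, h4.2, h3⟩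
  obtain ⟨R, hR1, hR⟩ := le_symbolIntegral_natCast hn hη (half_pos hL0) (by
    rw [← hL]; linarith)
  refine ⟨σ * Real.log R, fun ν => ?_⟩
  rw [multiplier_eq_symbolIntegral hβ]
  have hpos : 0 ≤ c * symbolIntegral δ β ν := mul_nonneg hc.le (symbolIntegral_nonneg _ _ _)
  rcases le_total (Real.log ‖ν‖) (Real.log R) with h | h
  · have := mul_le_mul_of_nonneg_left h hσ
    linarith
  · have h1 := rpow_mul_symbolIntegral_le hn hη hηδ hβn.le hβ ν
    have h2 := hR ν
    rw [← hL] at h2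
    have h3 : 2 * σ / (c * L) * ((L - L / 2) * (Real.log ‖ν‖ - Real.log R)) ≤
        symbolIntegral δ β ν := by
      refine le_trans ?_ h1
      refine mul_le_mul hηL h2 ?_ (by positivity)
      exact mul_nonneg (by linarith) (sub_nonneg.2 h)
    have h4 := mul_le_mul_of_nonneg_left h3 hc.le
    have h5 : c * (2 * σ / (c * L) * ((L - L / 2) * (Real.log ‖ν‖ - Real.log R))) =
        σ * (Real.log ‖ν‖ - Real.log R) := by
      field_simp
      ring
    rw [h5] at h4
    linarith

end SymbolIntegral

end NonlocalDiffusion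

namespace NonlocalDiffusion

/-! ### Averaging power series against Beta densities -/

open ProbabilityTheory (beta beta_pos)

/-- The power series `∑ c_j y^{j+1}` converges absolutely for `y ≥ 0`, with sum in `[0, K y]`. -/
def SeriesBetween (c : ℕ → ℝ) (K : ℝ) : Prop :=
  ∀ y, 0 ≤ y → (Summable fun j => |c j| * y ^ (j + 1)) ∧
    0 ≤ ∑' j, c j * y ^ (j + 1) ∧ ∑' j, c j * y ^ (j + 1) ≤ K * y

lemma integrableOn_beta {u v : ℝ} (hu : 0 < u) (hv : 0 < v) :
    IntegrableOn (fun x : ℝ => x ^ (u - 1) * (1 - x) ^ (v - 1)) (Set.Ioo 0 1) ∧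
      ∫ x in Set.Ioo (0 : ℝ) 1, x ^ (u - 1) * (1 - x) ^ (v - 1) = beta u v := by
  have h := (intervalIntegrable_iff_integrableOn_Ioo_of_le zero_le_one).1
    (Complex.betaIntegral_convergent (u := u) (v := v) (by simpa) (by simpa))
  have h1 : Set.EqOn (fun x : ℝ => ((x : ℂ) ^ ((u : ℂ) - 1) * (1 - (x : ℂ)) ^ ((v : ℂ) - 1)).re)
      (fun x : ℝ => x ^ (u - 1) * (1 - x) ^ (v - 1)) (Set.Ioo 0 1) := by
    intro x hx
    have h2 : (x : ℂ) ^ ((u : ℂ) - 1) = ((x ^ (u - 1) : ℝ) : ℂ) := by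
      rw [Complex.ofReal_cpow hx.1.le]
      push_cast
      rfl
    have h3 : (1 - (x : ℂ)) ^ ((v : ℂ) - 1) = (((1 - x) ^ (v - 1) : ℝ) : ℂ) := by
      rw [Complex.ofReal_cpow (sub_nonneg.2 hx.2.le)]
      push_cast
      rfl
    simp only [h2, h3]
    rw [← Complex.ofReal_mul, Complex.ofReal_re]
  refine ⟨IntegrableOn.congr_fun h.re h1 measurableSet_Ioo, ?_⟩
  rw [ProbabilityTheory.beta_eq_betaIntegralReal u v hu hv, Complex.betaIntegral,
    intervalIntegral.integral_of_le zero_le_one, integral_Ioc_eq_integral_Ioo,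
    ← setIntegral_congr_fun measurableSet_Ioo h1]
  exact integral_re h

lemma beta_add_one_left {u v : ℝ} (hu : 0 < u) (hv : 0 < v) :
    beta (u + 1) v = u / (u + v) * beta u v := by
  have h1 := Real.Gamma_add_one hu.ne'
  have h2 := Real.Gamma_add_one (add_pos hu hv).ne'
  have h3 := (Real.Gamma_pos_of_pos (add_pos hu hv)).ne'
  have h4 := (add_pos hu hv).ne'
  rw [ProbabilityTheory.beta, ProbabilityTheory.beta, h1, add_right_comm, h2]
  field_simp

lemma beta_add_natCast_le {u v : ℝ} (hu : 0 < u) (hv : 0 < v) (j : ℕ) :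
    beta (u + j) v ≤ beta u v := by
  induction j with
  | zero => simp
  | succ j ih =>
    have hj : 0 < u + j := by positivity
    rw [Nat.cast_succ, ← add_assoc, beta_add_one_left hj hv]
    refine (mul_le_of_le_one_left (beta_pos hj hv).le ?_).trans ih
    rw [div_le_one (by positivity)]
    linarith

/-- The new sum is `∫ x^{p-1} (1-x)^{q-1} S(xy) dx` over `(0, 1)`, where `S` is the old one, so both
bounds are inherited. Because `S(xy) = O(x)`, the density need not be integrable at `0`: `p > -1` is
enough, which is what permits the parameter `a ∈ (-1, 0]` later. -/
lemma SeriesBetween.beta_average {c : ℕ → ℝ} {K : ℝ} (h : SeriesBetween c K) {p q : ℝ}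
    (hp : -1 < p) (hq : 0 < q) :
    SeriesBetween (fun j => c j * beta (p + 1 + j) q) (K * beta (p + 1) q) := by
  have hp1 : 0 < p + 1 := by linarith
  have hpj : ∀ j : ℕ, 0 < p + 1 + j := fun j => by positivity
  intro y hy
  have hsum : Summable fun j => |c j| * y ^ (j + 1) * beta (p + 1 + j) q := by
    refine Summable.of_nonneg_of_le (fun j => ?_) (fun j => ?_)
      ((h y hy).1.mul_right (beta (p + 1) q))
    · have := (beta_pos (hpj j) hq).le
      positivity
    · exact mul_le_mul_of_nonneg_left (beta_add_natCast_le hp1 hq j) (by positivity)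
  let F : ℕ → ℝ → ℝ := fun j x =>
    c j * y ^ (j + 1) * (x ^ (p + 1 + j - 1) * (1 - x) ^ (q - 1))
  have hFint : ∀ j, IntegrableOn (F j) (Set.Ioo 0 1) := fun j =>
    (integrableOn_beta (hpj j) hq).1.const_mul _
  have hFval : ∀ j, ∫ x in Set.Ioo (0 : ℝ) 1, F j x = c j * beta (p + 1 + j) q * y ^ (j + 1) := by
    intro j
    simp only [F, integral_const_mul, (integrableOn_beta (hpj j) hq).2]
    ring
  have hFnorm : ∀ j, ∫ x in Set.Ioo (0 : ℝ) 1, ‖F j x‖ =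
      |c j| * y ^ (j + 1) * beta (p + 1 + j) q := by
    intro j
    rw [← (integrableOn_beta (hpj j) hq).2, ← integral_const_mul]
    refine setIntegral_congr_fun measurableSet_Ioo fun x hx => ?_
    have h1 : 0 ≤ x ^ (p + 1 + j - 1) * (1 - x) ^ (q - 1) :=
      mul_nonneg (Real.rpow_nonneg hx.1.le _) (Real.rpow_nonneg (sub_nonneg.2 hx.2.le) _)
    simp only [F]
    rw [norm_mul, norm_mul, Real.norm_of_nonneg h1, Real.norm_of_nonneg (pow_nonneg hy _),
      Real.norm_eq_abs]
  have hHS := hasSum_integral_of_summable_integral_norm hFint (by simpa only [hFnorm] using hsum)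
  simp only [hFval] at hHS
  have hpt : ∀ x ∈ Set.Ioo (0 : ℝ) 1, ∑' j, F j x =
      x ^ (p - 1) * (1 - x) ^ (q - 1) * ∑' j, c j * (x * y) ^ (j + 1) := by
    intro x hx
    rw [← tsum_mul_left]
    refine tsum_congr fun j => ?_
    have h1 : x ^ (p + 1 + j - 1) = x ^ (p - 1) * x ^ (j + 1) := by
      rw [← Real.rpow_natCast, ← Real.rpow_add hx.1]
      congr 1
      push_cast
      ring
    simp only [F]
    rw [h1, mul_pow]
    ring
  have hρ : ∀ x ∈ Set.Ioo (0 : ℝ) 1, 0 ≤ x ^ (p - 1) * (1 - x) ^ (q - 1) := fun x hx =>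
    mul_nonneg (Real.rpow_nonneg hx.1.le _) (Real.rpow_nonneg (sub_nonneg.2 hx.2.le) _)
  have hnn : ∀ x ∈ Set.Ioo (0 : ℝ) 1, 0 ≤ ∑' j, F j x := by
    intro x hx
    rw [hpt x hx]
    exact mul_nonneg (hρ x hx) (h _ (mul_nonneg hx.1.le hy)).2.1
  refine ⟨hsum.congr fun j => ?_, ?_, ?_⟩
  · rw [abs_mul, abs_of_pos (beta_pos (hpj j) hq)]
    ring
  · rw [hHS.tsum_eq]
    exact setIntegral_nonneg measurableSet_Ioo hnn
  · rw [hHS.tsum_eq]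
    calc ∫ x in Set.Ioo (0 : ℝ) 1, ∑' j, F j x
        ≤ ∫ x in Set.Ioo (0 : ℝ) 1, K * y * (x ^ (p + 1 - 1) * (1 - x) ^ (q - 1)) := by
          refine integral_mono_of_nonneg
            ((ae_restrict_iff' measurableSet_Ioo).2 (Eventually.of_forall hnn))
            ((integrableOn_beta hp1 hq).1.const_mul _)
            ((ae_restrict_iff' measurableSet_Ioo).2 (Eventually.of_forall fun x hx => ?_))
          beta_reduce
          rw [hpt x hx]
          refine (mul_le_mul_of_nonneg_left (h _ (mul_nonneg hx.1.le hy)).2.2 (hρ x hx)).trans_eq ?_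
          have h1 : x ^ (p + 1 - 1) = x ^ (p - 1) * x := by
            rw [← Real.rpow_add_one hx.1.ne']
            congr 1
            ring
          rw [h1]
          ring
      _ = K * beta (p + 1) q * y := by
          rw [integral_const_mul, (integrableOn_beta hp1 hq).2]
          ring

/-- The Taylor coefficients of `1 - cos (2 √y)`. -/
def oneSubCosCoeff (j : ℕ) : ℝ := (-1) ^ j * 4 ^ (j + 1) / (Nat.factorial (2 * (j + 1)) : ℝ)

lemma seriesBetween_oneSubCosCoeff : SeriesBetween oneSubCosCoeff 2 := by
  intro y hy
  have hy2 : √y ^ 2 = y := Real.sq_sqrt hy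
  have hterm : ∀ j : ℕ, (-1) ^ j * (2 * √y) ^ (2 * j) / (Nat.factorial (2 * j) : ℝ) =
      (-1) ^ j * (4 * y) ^ j / (Nat.factorial (2 * j) : ℝ) := fun j => by
    rw [pow_mul (2 * √y), mul_pow, hy2]
    norm_num
  have hcos := Real.hasSum_cos (2 * √y)
  simp only [hterm] at hcos
  have hs : Summable fun j : ℕ => |(-1) ^ j * (4 * y) ^ j / (Nat.factorial (2 * j) : ℝ)| :=
    hcos.summable.abs
  have hcoeff : ∀ j, oneSubCosCoeff j * y ^ (j + 1) =
      -((-1) ^ (j + 1) * (4 * y) ^ (j + 1) / (Nat.factorial (2 * (j + 1)) : ℝ)) := fun j => by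
    rw [oneSubCosCoeff, mul_pow]
    ring
  have htsum : ∑' j, oneSubCosCoeff j * y ^ (j + 1) = 1 - Real.cos (2 * √y) := by
    have h1 := hcos.summable.tsum_eq_zero_add
    rw [hcos.tsum_eq] at h1
    simp only [hcoeff, tsum_neg]
    rw [h1]
    simp
  refine ⟨((summable_nat_add_iff 1).2 hs).congr fun j => ?_, ?_, ?_⟩
  · rw [← abs_of_nonneg (pow_nonneg hy (j + 1)), ← abs_mul, hcoeff, abs_neg]
  · rw [htsum]
    exact sub_nonneg.2 (Real.cos_le_one _)
  · rw [htsum]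
    have := Real.one_sub_sq_div_two_le_cos (x := 2 * √y)
    rw [mul_pow, hy2] at this
    linarith

/-! ### The multipliers for `n + 2 ≤ β < n + 4` -/

/-- The absolute value of the coefficients of `₂F₃(1, a; 2, n/2 + 1, a + 1; -y)`, up to a positive
factor, for `a ∈ (-1, 0)`. -/
def averagedCoeff (b a : ℝ) (j : ℕ) : ℝ :=
  oneSubCosCoeff j * beta (1 / 2 + 1 + j) (b - 1 / 2) * beta (1 + 1 + j) 1 * beta (a + 1 + j) 1

lemma averagedCoeff_succ {b a : ℝ} (hb : 1 / 2 < b) (ha : -1 < a) (j : ℕ) :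
    averagedCoeff b a (j + 1) =
      -(a + (j + 1)) / ((j + 3) * (b + (j + 1)) * (a + (j + 2))) * averagedCoeff b a j := by
  have h1 : (0 : ℝ) < 1 / 2 + 1 + j := by positivity
  have h2 : (0 : ℝ) < 1 + 1 + j := by positivity
  have h3 : 0 < a + 1 + j := by
    have : (0 : ℝ) ≤ j := Nat.cast_nonneg j
    linarith
  have hfac : (Nat.factorial (2 * (j + 1 + 1)) : ℝ) =
      (2 * j + 4) * (2 * j + 3) * Nat.factorial (2 * (j + 1)) := by
    have : 2 * (j + 1 + 1) = 2 * (j + 1) + 1 + 1 := by ring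
    rw [this, Nat.factorial_succ, Nat.factorial_succ]
    push_cast
    ring
  have hf0 : (Nat.factorial (2 * (j + 1)) : ℝ) ≠ 0 := by positivity
  simp only [averagedCoeff, oneSubCosCoeff, Nat.cast_succ, ← add_assoc]
  rw [beta_add_one_left h1 (by linarith), beta_add_one_left h2 one_pos,
    beta_add_one_left h3 one_pos, hfac]
  have h4 : (0 : ℝ) < b + j + 1 := by
    have : (0 : ℝ) ≤ j := Nat.cast_nonneg j
    linarith
  have h5 : 1 / 2 + 1 + (j : ℝ) + (b - 1 / 2) = b + j + 1 := by ring
  have h6 : a + j + 2 ≠ 0 := by linarith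
  have h7 : a + 1 + (j : ℝ) + 1 = a + j + 2 := by ring
  rw [h5, h7]
  field_simp
  ring

/-- Both sides have the same ratio of consecutive terms and agree at `j = 0`. In Pochhammer terms
the three averages trade `1/2` for `b`, insert `(1)_{j+1} / (2)_{j+1}`, and insert `(a)_{j+1} /
(a+1)_{j+1}` up to a factor `a`. The index is shifted because the constant term `1` of the
hypergeometric series is split off. -/
lemma hypergeometric_term_succ {a b : ℝ} (hb : 1 / 2 < b) (ha : -1 < a) (j : ℕ) :
    (ascPochhammer ℝ (j + 1)).eval 1 * (ascPochhammer ℝ (j + 1)).eval a /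
      ((ascPochhammer ℝ (j + 1)).eval 2 * (ascPochhammer ℝ (j + 1)).eval b *
        (ascPochhammer ℝ (j + 1)).eval (a + 1)) / (Nat.factorial (j + 1) : ℝ) * (-1) ^ (j + 1) =
      -a / (2 * b * (a + 1)) / averagedCoeff b a 0 * averagedCoeff b a j := by
  have hc0 : averagedCoeff b a 0 ≠ 0 := by
    have h1 := (beta_pos (α := 1 / 2 + 1) (β := b - 1 / 2) (by norm_num) (by linarith)).ne'
    have h2 := (beta_pos (α := 1 + 1) (β := 1) (by norm_num) (by linarith)).ne'
    have h3 := (beta_pos (α := a + 1) (β := 1) (by linarith) (by linarith)).ne'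
    simp only [averagedCoeff, oneSubCosCoeff, Nat.cast_zero, add_zero]
    have : (Nat.factorial (2 * (0 + 1)) : ℝ) ≠ 0 := by positivity
    positivity
  have hb0 : b ≠ 0 := by linarith
  have ha0 : a + 1 ≠ 0 := by linarith
  induction j with
  | zero =>
    simp
    field_simp
  | succ j ih =>
    have hj : (0 : ℝ) ≤ j := Nat.cast_nonneg j
    rw [averagedCoeff_succ hb ha, mul_left_comm, ← ih]
    simp only [ascPochhammer_succ_eval (n := j + 1), Nat.factorial_succ (j + 1)]
    have hp2 : (ascPochhammer ℝ (j + 1)).eval 2 ≠ 0 := (ascPochhammer_pos _ _ (by norm_num)).ne'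
    have hpb : (ascPochhammer ℝ (j + 1)).eval b ≠ 0 := (ascPochhammer_pos _ _ (by linarith)).ne'
    have hpa : (ascPochhammer ℝ (j + 1)).eval (a + 1) ≠ 0 :=
      (ascPochhammer_pos _ _ (by linarith)).ne'
    have hf : (Nat.factorial (j + 1) : ℝ) ≠ 0 := by positivity
    have h1 : (2 : ℝ) + (j + 1) ≠ 0 := by positivity
    have h2 : b + (j + 1) ≠ 0 := by linarith
    have h3 : a + 1 + (j + 1) ≠ 0 := by linarith
    have h4 : a + (j + 2) ≠ 0 := by linarith
    have h5 : (j : ℝ) + 1 + 1 ≠ 0 := by positivity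
    have h6 : (j : ℝ) + 3 ≠ 0 := by positivity
    have h7 : a + 1 + ((j : ℝ) + 1) = a + (j + 2) := by ring
    push_cast
    rw [h7, pow_succ (-1 : ℝ) (j + 1)]
    field_simp
    ring

/-- The series equals `1` plus `D` times a threefold Beta average of `1 - cos (2√y)`, which lies
between `0` and `2y`; the sign of `a` gives `D ≥ 0`. The lower bound yields decay of the propagator,
the upper one polynomial growth of the multiplier. -/
lemma hypergeometric23_bounds {a b : ℝ} (hb : 1 / 2 < b) (ha : -1 < a) (ha0 : a ≤ 0) :
    ∃ C, 0 ≤ C ∧ ∀ y, 0 ≤ y → 1 ≤ hypergeometric23 1 a 2 b (a + 1) (-y) ∧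
      hypergeometric23 1 a 2 b (a + 1) (-y) ≤ 1 + C * y := by
  have h := ((seriesBetween_oneSubCosCoeff.beta_average (p := 1 / 2) (q := b - 1 / 2)
    (by norm_num) (by linarith)).beta_average (p := 1) (q := 1) (by norm_num)
    one_pos).beta_average ha one_pos
  set K := 2 * beta (1 / 2 + 1) (b - 1 / 2) * beta (1 + 1) 1 * beta (a + 1) 1
  change SeriesBetween (averagedCoeff b a) K at h
  have hB1 := beta_pos (α := 1 / 2 + 1) (β := b - 1 / 2) (by norm_num) (by linarith)
  have hB2 := beta_pos (α := 1 + 1) (β := 1) (by norm_num) (by linarith)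
  have hB3 := beta_pos (α := a + 1) (β := 1) (by linarith) (by linarith)
  have hc0 : 0 < averagedCoeff b a 0 := by
    simp only [averagedCoeff, oneSubCosCoeff, Nat.cast_zero, add_zero]
    positivity
  set D := -a / (2 * b * (a + 1)) / averagedCoeff b a 0 with hD
  have hD0 : 0 ≤ D := by
    refine div_nonneg (div_nonneg (by linarith) ?_) hc0.le
    exact mul_nonneg (by linarith) (by linarith)
  refine ⟨D * K, by positivity, fun y hy => ?_⟩
  obtain ⟨hs, hlo, hhi⟩ := h y hy
  have hterm : ∀ j : ℕ, (ascPochhammer ℝ (j + 1)).eval 1 * (ascPochhammer ℝ (j + 1)).eval a /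
      ((ascPochhammer ℝ (j + 1)).eval 2 * (ascPochhammer ℝ (j + 1)).eval b *
        (ascPochhammer ℝ (j + 1)).eval (a + 1)) * ((-y) ^ (j + 1) / (Nat.factorial (j + 1) : ℝ)) =
      D * (averagedCoeff b a j * y ^ (j + 1)) := by
    intro j
    rw [← mul_assoc, hD, ← hypergeometric_term_succ hb ha, neg_pow y]
    ring
  have hs' : Summable fun j => averagedCoeff b a j * y ^ (j + 1) := by
    refine Summable.of_abs (hs.congr fun j => ?_)
    rw [abs_mul, abs_of_nonneg (pow_nonneg hy _)]
  have hval : hypergeometric23 1 a 2 b (a + 1) (-y) =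
      1 + D * ∑' j, averagedCoeff b a j * y ^ (j + 1) := by
    rw [hypergeometric23, Summable.tsum_eq_zero_add]
    · simp only [hterm, tsum_mul_left]
      simp
    · refine (summable_nat_add_iff 1).1 ?_
      simp only [hterm]
      exact hs'.mul_left D
  rw [hval]
  constructor
  · linarith [mul_nonneg hD0 hlo]
  · have := mul_le_mul_of_nonneg_left hhi hD0
    linarith

section

variable {n : ℕ} {δ β : ℝ}

lemma multiplier_bounds_of_le (hn : 1 ≤ n) (hβ₂ : n + 2 ≤ β) (hβ : β < n + 4) :
    ∃ C, 0 ≤ C ∧ ∀ ν : EuclideanSpace ℝ (Fin n), multiplier δ β ν ≤ -‖ν‖ ^ 2 ∧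
      -(‖ν‖ ^ 2 * (1 + C * ‖ν‖ ^ 2)) ≤ multiplier δ β ν := by
  have hn' : (1 : ℝ) ≤ n := by exact_mod_cast hn
  obtain ⟨C, hC, h⟩ := hypergeometric23_bounds (a := ((n : ℝ) + 2 - β) / 2)
    (b := ((n : ℝ) + 2) / 2) (by linarith) (by linarith) (by linarith)
  refine ⟨C * (1 / 4 * δ ^ 2), by positivity, fun ν => ?_⟩
  obtain ⟨h1, h2⟩ := h (1 / 4 * ‖ν‖ ^ 2 * δ ^ 2) (by positivity)
  have h3 : ((n : ℝ) + 2 - β) / 2 + 1 = ((n : ℝ) + 4 - β) / 2 := by ring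
  have h4 : -(1 / 4 * ‖ν‖ ^ 2 * δ ^ 2) = -(1 / 4) * ‖ν‖ ^ 2 * δ ^ 2 := by ring
  rw [h3, h4] at h1 h2
  rw [multiplier, if_neg (not_lt.2 hβ₂)]
  have h5 : 0 ≤ ‖ν‖ ^ 2 := by positivity
  have h6 := mul_le_mul_of_nonneg_left h1 h5
  have h7 := mul_le_mul_of_nonneg_left h2 h5
  constructor
  · linarith
  · linarith

/-! ### Bounds on the multipliers in the full range -/

lemma multiplier_nonpos (hn : 1 ≤ n) (hδ : 0 < δ) (hβ : β < n + 4)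
    (ν : EuclideanSpace ℝ (Fin n)) : multiplier δ β ν ≤ 0 := by
  rcases lt_or_ge β (n + 2) with h | h
  · rw [multiplier_eq_symbolIntegral h, neg_nonpos]
    exact mul_nonneg (scalingConst_pos hδ h).le (symbolIntegral_nonneg _ _ _)
  · obtain ⟨C, -, hC⟩ := multiplier_bounds_of_le (δ := δ) hn h hβ
    exact (hC ν).1.trans (by simp)

lemma abs_multiplier_le (hn : 1 ≤ n) (hδ : 0 < δ) (hβ : β < n + 4) :
    ∃ C, 0 ≤ C ∧ ∀ ν : EuclideanSpace ℝ (Fin n), |multiplier δ β ν| ≤ C * (1 + ‖ν‖) ^ 4 := by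
  have h4 : ∀ x : ℝ, 0 ≤ x → x ^ 2 ≤ (1 + x) ^ 4 ∧ x ^ 4 ≤ (1 + x) ^ 4 := fun x hx => by
    constructor
    · calc x ^ 2 ≤ (1 + x) ^ 2 := by gcongr; linarith
        _ ≤ (1 + x) ^ 4 := pow_le_pow_right₀ (by linarith) (by norm_num)
    · gcongr
      linarith
  rcases lt_or_ge β (n + 2) with h | h
  · obtain ⟨C, hC, hle⟩ := symbolIntegral_le hn hδ h
    have hc := (scalingConst_pos (n := n) hδ h).le
    refine ⟨scalingConst n δ β * C, mul_nonneg hc hC, fun ν => ?_⟩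
    rw [multiplier_eq_symbolIntegral h, abs_neg,
      abs_of_nonneg (mul_nonneg hc (symbolIntegral_nonneg _ _ _)), mul_assoc]
    refine mul_le_mul_of_nonneg_left ((hle ν).trans ?_) hc
    exact mul_le_mul_of_nonneg_left (h4 _ (norm_nonneg ν)).1 hC
  · obtain ⟨C, hC0, hC⟩ := multiplier_bounds_of_le (δ := δ) hn h hβ
    refine ⟨1 + C, by linarith, fun ν => ?_⟩
    rw [abs_of_nonpos (multiplier_nonpos hn hδ hβ ν)]
    have h5 := h4 _ (norm_nonneg ν)
    have h6 := mul_le_mul_of_nonneg_left h5.2 hC0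
    linarith [(hC ν).2]

lemma multiplier_le_sub_log (hn : 1 ≤ n) (hδ : 0 < δ) (hβn : n < β) (hβ : β < n + 4)
    {σ : ℝ} (hσ : 0 ≤ σ) :
    ∃ C, ∀ ν : EuclideanSpace ℝ (Fin n), multiplier δ β ν ≤ C - σ * Real.log ‖ν‖ := by
  rcases lt_or_ge β (n + 2) with h | h
  · exact multiplier_le_of_natCast_lt hn hδ hβn h hσ
  · obtain ⟨C, -, hC⟩ := multiplier_bounds_of_le (δ := δ) hn h hβ
    refine ⟨σ ^ 2, fun ν => (hC ν).1.trans ?_⟩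
    have h1 := Real.log_le_self (norm_nonneg ν)
    have h2 := mul_le_mul_of_nonneg_left h1 hσ
    nlinarith [sq_nonneg (‖ν‖ - σ / 2), sq_nonneg σ]

end

end NonlocalDiffusion

namespace NonlocalDiffusion

variable {n : ℕ} {r : Fin n → ℝ}

/-! ### Sobolev spaces in terms of Fourier coefficients -/

lemma sobolevNormSq_eq (q : ℝ) (h : PeriodicDistribution r) :
    sobolevNormSq q h = ∑' k, ENNReal.ofReal (latticeWeight k ^ q * ‖distCoeff h k‖ ^ 2) := rfl

lemma sobolevTerm_nonneg (q : ℝ) (k : Fin n → ℤ) (z : ℂ) : 0 ≤ latticeWeight k ^ q * ‖z‖ ^ 2 :=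
  mul_nonneg (Real.rpow_nonneg (latticeWeight_pos k).le _) (sq_nonneg _)

lemma MemSobolev.summable {q : ℝ} {h : PeriodicDistribution r} (hh : MemSobolev q h) :
    Summable fun k => latticeWeight k ^ q * ‖distCoeff h k‖ ^ 2 := by
  refine (ENNReal.summable_toReal hh.ne).congr fun k => ?_
  exact ENNReal.toReal_ofReal (sobolevTerm_nonneg q k _)

lemma MemSobolev.norm_distCoeff_le {q : ℝ} {h : PeriodicDistribution r} (hh : MemSobolev q h) :
    ∃ (C : ℝ) (N : ℕ), ∀ k, ‖distCoeff h k‖ ≤ C * latticeWeight k ^ N := by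
  obtain ⟨N, hN⟩ := exists_nat_ge (-q)
  set S := ∑' k, latticeWeight k ^ q * ‖distCoeff h k‖ ^ 2 with hS
  have hS0 : 0 ≤ S := tsum_nonneg fun k => sobolevTerm_nonneg q k _
  refine ⟨1 + S, N, fun k => ?_⟩
  have hw := one_le_latticeWeight k
  have hw0 := latticeWeight_pos k
  have h1 : latticeWeight k ^ q * ‖distCoeff h k‖ ^ 2 ≤ S :=
    hh.summable.le_tsum k fun j _ => sobolevTerm_nonneg q j _
  have h2 : ‖distCoeff h k‖ ^ 2 ≤ S * latticeWeight k ^ N := by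
    calc ‖distCoeff h k‖ ^ 2
        = latticeWeight k ^ q * ‖distCoeff h k‖ ^ 2 * latticeWeight k ^ (-q) := by
          rw [Real.rpow_neg hw0.le]
          have := (Real.rpow_pos_of_pos hw0 q).ne'
          field_simp
      _ ≤ S * latticeWeight k ^ (N : ℝ) := by
          gcongr
      _ = S * latticeWeight k ^ N := by rw [Real.rpow_natCast]
  have h3 : 1 ≤ latticeWeight k ^ N := one_le_pow₀ hw
  nlinarith [norm_nonneg (distCoeff h k), sq_nonneg (‖distCoeff h k‖ - 1)]

lemma sobolevNormSq_le_of_forall_le {q s A : ℝ} (hA : 0 ≤ A) {g f : PeriodicDistribution r}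
    (h : ∀ k, latticeWeight k ^ q * ‖distCoeff g k‖ ^ 2 ≤
      A * (latticeWeight k ^ s * ‖distCoeff f k‖ ^ 2)) :
    sobolevNormSq q g ≤ ENNReal.ofReal A * sobolevNormSq s f := by
  rw [sobolevNormSq_eq, sobolevNormSq_eq, ← ENNReal.tsum_mul_left]
  refine ENNReal.tsum_le_tsum fun k => ?_
  rw [← ENNReal.ofReal_mul hA]
  exact ENNReal.ofReal_le_ofReal (h k)

/-- A single term is bounded by the whole sum, and its weight is a positive constant, so the value
of `q` plays no role. Uniqueness for every `q` rests on this. -/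
lemma tendsto_distCoeff_of_sobolevNormSq {ι : Type*} {l : Filter ι} {q : ℝ}
    {g : ι → PeriodicDistribution r} (h : Tendsto (fun i => sobolevNormSq q (g i)) l (𝓝 0))
    (k : Fin n → ℤ) : Tendsto (fun i => distCoeff (g i) k) l (𝓝 0) := by
  have h1 : Tendsto (fun i => ENNReal.ofReal (latticeWeight k ^ q * ‖distCoeff (g i) k‖ ^ 2)) l
      (𝓝 0) :=
    tendsto_of_tendsto_of_tendsto_of_le_of_le tendsto_const_nhds h (fun _ => zero_le)
      fun i => ENNReal.le_tsum k
  have h2 := (ENNReal.tendsto_toReal ENNReal.zero_ne_top).comp h1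
  have h3 : Tendsto (fun i => latticeWeight k ^ q * ‖distCoeff (g i) k‖ ^ 2) l (𝓝 0) := by
    refine h2.congr fun i => ?_
    exact ENNReal.toReal_ofReal (sobolevTerm_nonneg q k _)
  have h4 := h3.const_mul (latticeWeight k ^ q)⁻¹
  have hne := (Real.rpow_pos_of_pos (latticeWeight_pos k) q).ne'
  simp only [inv_mul_cancel_left₀ hne, mul_zero] at h4
  have h5 := h4.sqrt
  simp only [Real.sqrt_sq (norm_nonneg _), Real.sqrt_zero] at h5
  exact tendsto_zero_iff_norm_tendsto_zero.2 h5

lemma distCoeff_sub (g h : PeriodicDistribution r) (k : Fin n → ℤ) :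
    distCoeff (g - h) k = distCoeff g k - distCoeff h k :=
  mul_sub _ _ _

lemma distCoeff_smul (c : ℂ) (h : PeriodicDistribution r) (k : Fin n → ℤ) :
    distCoeff (c • h) k = c * distCoeff h k :=
  mul_left_comm _ _ _

/-! ### The exponential propagator -/

lemma abs_pow_mul_exp_le {μ θ : ℝ} (hμ : μ ≤ 0) (hθ : 0 < θ) (N : ℕ) :
    |μ| ^ N * Real.exp (μ * θ) ≤ Nat.factorial N / θ ^ N := by
  have h1 := Real.pow_div_factorial_le_exp (-(μ * θ))
    (neg_nonneg.2 (mul_nonpos_of_nonpos_of_nonneg hμ hθ.le)) N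
  have h2 : -(μ * θ) = |μ| * θ := by rw [abs_of_nonpos hμ]; ring
  rw [h2, mul_pow, div_le_iff₀ (by positivity)] at h1
  have h3 : Real.exp (μ * θ) * Real.exp (|μ| * θ) = 1 := by
    rw [← Real.exp_add, ← h2]
    simp
  rw [le_div_iff₀ (by positivity)]
  calc |μ| ^ N * Real.exp (μ * θ) * θ ^ N = |μ| ^ N * θ ^ N * Real.exp (μ * θ) := by ring
    _ ≤ Real.exp (|μ| * θ) * Nat.factorial N * Real.exp (μ * θ) := by gcongr
    _ = Nat.factorial N := by linear_combination (Nat.factorial N : ℝ) * h3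

/-- The second-order Taylor remainder of `e^{μh}` costs a factor `e^{|μh|}` for either sign of `h`;
stepping back from `t` to `t₁` pays for it. -/
lemma abs_exp_difference_quotient_le {μ t h t₁ : ℝ} (hμ : μ ≤ 0) (hh : h ≠ 0)
    (ht : t₁ + |h| ≤ t) :
    |h⁻¹ * (Real.exp (μ * (t + h)) - Real.exp (μ * t)) - μ * Real.exp (μ * t)| ≤
      |h| * (|μ| ^ 2 * Real.exp (μ * t₁)) := by
  have h1 := Complex.norm_exp_sub_sum_le_norm_mul_exp ((μ * h : ℝ) : ℂ) 2
  simp only [Finset.sum_range_succ, Finset.sum_range_zero] at h1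
  norm_num at h1
  have h2 : |Real.exp (μ * h) - (1 + μ * h)| ≤ |μ * h| ^ 2 * Real.exp |μ * h| := by
    have h3 : ((Real.exp (μ * h) - (1 + μ * h) : ℝ) : ℂ) =
        Complex.exp (μ * h) - (1 + μ * h) := by
      push_cast
      ring
    rw [← Real.norm_eq_abs (Real.exp (μ * h) - (1 + μ * h)), ← Complex.norm_real, h3, abs_mul]
    exact h1
  have h4 : h⁻¹ * (Real.exp (μ * (t + h)) - Real.exp (μ * t)) - μ * Real.exp (μ * t) =
      h⁻¹ * (Real.exp (μ * t) * (Real.exp (μ * h) - (1 + μ * h))) := by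
    rw [mul_add, Real.exp_add]
    field_simp
    ring
  have h5 : Real.exp (μ * t) * Real.exp |μ * h| ≤ Real.exp (μ * t₁) := by
    rw [← Real.exp_add, abs_mul, abs_of_nonpos hμ]
    exact Real.exp_le_exp.2 (by nlinarith)
  have hh' : 0 < |h| := abs_pos.2 hh
  rw [h4, abs_mul, abs_mul, abs_inv, Real.abs_exp]
  calc |h|⁻¹ * (Real.exp (μ * t) * |Real.exp (μ * h) - (1 + μ * h)|)
      ≤ |h|⁻¹ * (Real.exp (μ * t) * (|μ * h| ^ 2 * Real.exp |μ * h|)) := by gcongr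
    _ = |h| * (|μ| ^ 2 * (Real.exp (μ * t) * Real.exp |μ * h|)) := by
        rw [abs_mul]
        field_simp
    _ ≤ |h| * (|μ| ^ 2 * Real.exp (μ * t₁)) := by gcongr

/-- The Fourier coefficients of the `N`-th time derivative of `∑ f̂_k e^{μ_k t} e^{i ν_k · x}`. -/
def propagatorCoeff (f : PeriodicDistribution r) (μ : (Fin n → ℤ) → ℝ) (N : ℕ) (t : ℝ)
    (k : Fin n → ℤ) : ℂ :=
  distCoeff f k * (μ k : ℂ) ^ N * Complex.exp ((μ k * t : ℝ) : ℂ)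

/-- `D N t` has, for `t ≥ 0`, the Fourier coefficients `f̂_k μ_k^N e^{μ_k t}`. -/
def IsPropagator (f : PeriodicDistribution r) (μ : (Fin n → ℤ) → ℝ)
    (D : ℕ → ℝ → PeriodicDistribution r) : Prop :=
  ∀ N t, 0 ≤ t → HasFourierSeries (propagatorCoeff f μ N t) (D N t)

lemma norm_propagatorCoeff (f : PeriodicDistribution r) (μ : (Fin n → ℤ) → ℝ) (N : ℕ) (t : ℝ)
    (k : Fin n → ℤ) :
    ‖propagatorCoeff f μ N t k‖ = ‖distCoeff f k‖ * (|μ k| ^ N * Real.exp (μ k * t)) := by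
  rw [propagatorCoeff, norm_mul, norm_mul, norm_pow, Complex.norm_exp_ofReal, Complex.norm_real,
    Real.norm_eq_abs, mul_assoc]

lemma exists_isPropagator (hr : ∀ i, 0 < r i) {s : ℝ} {f : PeriodicDistribution r}
    (hf : MemSobolev s f) {μ : (Fin n → ℤ) → ℝ} (hμ : ∀ k, μ k ≤ 0) {B : ℝ} {P : ℕ}
    (hμB : ∀ k, |μ k| ≤ B * latticeWeight k ^ P) :
    ∃ D : ℕ → ℝ → PeriodicDistribution r, IsPropagator f μ D := by
  obtain ⟨C, M, hC⟩ := hf.norm_distCoeff_le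
  have h : ∀ (N : ℕ) (t : ℝ), ∃ W : PeriodicDistribution r,
      0 ≤ t → HasFourierSeries (propagatorCoeff f μ N t) W := by
    intro N t
    by_cases ht : 0 ≤ t
    · obtain ⟨W, hW⟩ := exists_hasFourierSeries hr (C := C * B ^ N) (N := M + P * N)
        (c := propagatorCoeff f μ N t) fun k => by
          have hexp : Real.exp (μ k * t) ≤ 1 :=
            Real.exp_le_one_iff.2 (mul_nonpos_of_nonpos_of_nonneg (hμ k) ht)
          rw [norm_propagatorCoeff]
          calc ‖distCoeff f k‖ * (|μ k| ^ N * Real.exp (μ k * t))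
              ≤ C * latticeWeight k ^ M * ((B * latticeWeight k ^ P) ^ N * 1) := by
                have h0 := (norm_nonneg _).trans (hC k)
                have h1 := (abs_nonneg _).trans (hμB k)
                gcongr
                · exact hC k
                · exact hμB k
            _ = _ := by
                rw [mul_pow, pow_add, pow_mul]
                ring
      exact ⟨W, fun _ => hW⟩
    -- Nothing is prescribed at negative times, where the coefficients may grow too fast to define a
    -- distribution.
    · exact ⟨0, fun h => absurd h ht⟩
  choose D hD using h
  exact ⟨D, hD⟩

lemma IsPropagator.distCoeff_eq (hr : ∀ i, 0 < r i) {f : PeriodicDistribution r}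
    {μ : (Fin n → ℤ) → ℝ} {D : ℕ → ℝ → PeriodicDistribution r} (hD : IsPropagator f μ D)
    (N : ℕ) {t : ℝ} (ht : 0 ≤ t) (k : Fin n → ℤ) :
    distCoeff (D N t) k = propagatorCoeff f μ N t k :=
  distCoeff_eq_of_hasFourierSeries hr (hD N t ht) k

/-- The propagator gains `σ` derivatives in `L²` before time `t`. -/
def SmoothingGain (μ : (Fin n → ℤ) → ℝ) (σ t : ℝ) : Prop :=
  ∃ t₁ A : ℝ, 0 < t₁ ∧ t₁ < t ∧ ∀ k, latticeWeight k ^ σ * Real.exp (μ k * t₁) ^ 2 ≤ A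

lemma smoothingGain_zero {μ : (Fin n → ℤ) → ℝ} (hμ : ∀ k, μ k ≤ 0) {t : ℝ} (ht : 0 < t) :
    SmoothingGain μ 0 t := by
  refine ⟨t / 2, 1, by positivity, by linarith, fun k => ?_⟩
  rw [Real.rpow_zero, one_mul]
  exact pow_le_one₀ (Real.exp_pos _).le (Real.exp_le_one_iff.2
    (mul_nonpos_of_nonpos_of_nonneg (hμ k) (by positivity)))

/-- Writing `w` for the weight, `w^p e^{2 μ t₁} ≤ e^{2 C t₁} w^{p - 2 σ t₁}`, and `w ≥ 1`. -/
lemma smoothingGain_of_log {μ : (Fin n → ℤ) → ℝ} {C σ : ℝ}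
    (hμ : ∀ k, μ k ≤ C - σ * Real.log (latticeWeight k)) {p t₁ t : ℝ} (ht₁ : 0 < t₁)
    (ht : t₁ < t) (hp : p ≤ 2 * σ * t₁) : SmoothingGain μ p t := by
  refine ⟨t₁, Real.exp (2 * C * t₁), ht₁, ht, fun k => ?_⟩
  have hw := latticeWeight_pos k
  have hlog := Real.log_nonneg (one_le_latticeWeight k)
  rw [Real.rpow_def_of_pos hw, ← Real.exp_nat_mul, ← Real.exp_add]
  refine Real.exp_le_exp.2 ?_
  have h1 := mul_le_mul_of_nonneg_right (hμ k) ht₁.le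
  have h2 := mul_le_mul_of_nonneg_left hp hlog
  push_cast
  linarith

/-- The strict inequality `t₁ < t` is an open condition, so the order reached at `t` is available at
all nearby times, as `SmoothInto` demands. -/
lemma SmoothingGain.eventually {μ : (Fin n → ℤ) → ℝ} {σ t : ℝ} (h : SmoothingGain μ σ t) :
    ∀ᶠ τ in 𝓝 t, SmoothingGain μ σ τ := by
  obtain ⟨t₁, A, h1, h2, h3⟩ := h
  filter_upwards [lt_mem_nhds h2] with τ hτ
  exact ⟨t₁, A, h1, hτ, h3⟩

/-- Split `e^{μ t₂} = e^{μ t₁} e^{μ (t₂ - t₁)}`: the first factor raises the Sobolev order from `s`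
to `q`, the second absorbs `|μ|^N`. -/
lemma sobolevTerm_le_of_gain {q s t₁ t₂ A : ℝ} {μ : (Fin n → ℤ) → ℝ} (hμ : ∀ k, μ k ≤ 0)
    (ht : t₁ < t₂)
    (hA : ∀ k, latticeWeight k ^ (q - s) * Real.exp (μ k * t₁) ^ 2 ≤ A) (N : ℕ)
    (k : Fin n → ℤ) {z a : ℂ} {c : ℝ} (hc : 0 ≤ c)
    (hz : ‖z‖ ≤ c * (‖a‖ * (|μ k| ^ N * Real.exp (μ k * t₂)))) :
    latticeWeight k ^ q * ‖z‖ ^ 2 ≤ c ^ 2 * (A * (Nat.factorial N / (t₂ - t₁) ^ N) ^ 2) *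
      (latticeWeight k ^ s * ‖a‖ ^ 2) := by
  have hw := latticeWeight_pos k
  have hθ : 0 < t₂ - t₁ := sub_pos.2 ht
  have h1 := abs_pow_mul_exp_le (hμ k) hθ N
  set B := Nat.factorial N / (t₂ - t₁) ^ N
  have h2 : Real.exp (μ k * t₂) = Real.exp (μ k * t₁) * Real.exp (μ k * (t₂ - t₁)) := by
    rw [← Real.exp_add]
    ring_nf
  have h3 : ‖z‖ ≤ c * (‖a‖ * (Real.exp (μ k * t₁) * B)) := by
    refine hz.trans ?_
    rw [h2, mul_left_comm (|μ k| ^ N)]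
    gcongr
  have h4 : latticeWeight k ^ q = latticeWeight k ^ s * latticeWeight k ^ (q - s) := by
    rw [← Real.rpow_add hw]
    ring_nf
  calc latticeWeight k ^ q * ‖z‖ ^ 2
      ≤ latticeWeight k ^ q * (c * (‖a‖ * (Real.exp (μ k * t₁) * B))) ^ 2 := by gcongr
    _ = latticeWeight k ^ (q - s) * Real.exp (μ k * t₁) ^ 2 *
          (c ^ 2 * B ^ 2 * (latticeWeight k ^ s * ‖a‖ ^ 2)) := by
        rw [h4]
        ring
    _ ≤ A * (c ^ 2 * B ^ 2 * (latticeWeight k ^ s * ‖a‖ ^ 2)) := by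
        gcongr
        exact hA k
    _ = _ := by ring

lemma IsPropagator.memSobolev (hr : ∀ i, 0 < r i) {s q : ℝ} {f : PeriodicDistribution r}
    (hf : MemSobolev s f) {μ : (Fin n → ℤ) → ℝ} (hμ : ∀ k, μ k ≤ 0)
    {D : ℕ → ℝ → PeriodicDistribution r} (hD : IsPropagator f μ D) {t : ℝ}
    (hgain : SmoothingGain μ (q - s) t) (N : ℕ) : MemSobolev q (D N t) := by
  obtain ⟨t₁, A, ht₁, ht, hA⟩ := hgain
  have hA0 : 0 ≤ A := by
    have := Real.rpow_nonneg (latticeWeight_pos (0 : Fin n → ℤ)).le (q - s)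
    exact le_trans (by positivity) (hA 0)
  refine (sobolevNormSq_le_of_forall_le (f := f) (s := s)
    (A := 1 ^ 2 * (A * (Nat.factorial N / (t - t₁) ^ N) ^ 2)) (by positivity) fun k =>
      sobolevTerm_le_of_gain hμ ht hA N k zero_le_one ?_).trans_lt
        (ENNReal.mul_lt_top ENNReal.ofReal_lt_top hf)
  rw [hD.distCoeff_eq hr N (ht₁.trans ht).le, norm_propagatorCoeff, one_mul]

/-- The error of the difference quotient is at most `|h|` times a term of order `N + 2` at an
earlier time, hence its squared norm is `O(h²)` uniformly in `k`. -/
lemma IsPropagator.hasGateauxDerivAt (hr : ∀ i, 0 < r i) {s q : ℝ} {f : PeriodicDistribution r}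
    (hf : MemSobolev s f) {μ : (Fin n → ℤ) → ℝ} (hμ : ∀ k, μ k ≤ 0)
    {D : ℕ → ℝ → PeriodicDistribution r} (hD : IsPropagator f μ D) {t : ℝ}
    (hgain : SmoothingGain μ (q - s) t) (N : ℕ) :
    HasGateauxDerivAt q (D N) (D (N + 1) t) t := by
  refine ⟨hgain.eventually.mono fun τ hτ => hD.memSobolev hr hf hμ hτ N,
    hD.memSobolev hr hf hμ hgain (N + 1), ?_⟩
  obtain ⟨t₁, A, ht₁, ht, hA⟩ := hgain
  have hA0 : 0 ≤ A := by
    have := Real.rpow_nonneg (latticeWeight_pos (0 : Fin n → ℤ)).le (q - s)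
    exact le_trans (by positivity) (hA 0)
  -- Time is shared three ways: up to `t₁` for the Sobolev gain, from `t₁` to `t₂` for the powers of
  -- `μ`, from `t₂` to `t` for the step `h`.
  set t₂ := (t₁ + t) / 2 with ht₂
  have ht₁₂ : t₁ < t₂ := by linarith
  set B := A * (Nat.factorial (N + 2) / (t₂ - t₁) ^ (N + 2)) ^ 2 with hB
  have hB0 : 0 ≤ B := by positivity
  have hbound : ∀ᶠ h : ℝ in 𝓝[≠] 0,
      sobolevNormSq q (((h⁻¹ : ℝ) : ℂ) • (D N (t + h) - D N t) - D (N + 1) t) ≤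
        ENNReal.ofReal (|h| ^ 2 * B) * sobolevNormSq s f := by
    have hsmall : ∀ᶠ h : ℝ in 𝓝[≠] 0, |h| < t - t₂ := by
      have : Tendsto (fun h : ℝ => |h|) (𝓝[≠] 0) (𝓝 0) := by
        simpa using (continuous_abs.tendsto (0 : ℝ)).mono_left nhdsWithin_le_nhds
      exact this.eventually (gt_mem_nhds (by linarith))
    filter_upwards [hsmall, self_mem_nhdsWithin] with h hh hh0
    have hth : 0 ≤ t + h := by linarith [neg_abs_le h]
    refine sobolevNormSq_le_of_forall_le (by positivity) fun k =>
      sobolevTerm_le_of_gain hμ ht₁₂ hA (N + 2) k (abs_nonneg h) ?_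
    rw [distCoeff_sub, distCoeff_smul, distCoeff_sub, hD.distCoeff_eq hr N hth,
      hD.distCoeff_eq hr N (ht₁.trans ht).le, hD.distCoeff_eq hr (N + 1) (ht₁.trans ht).le]
    have hfac : ((h⁻¹ : ℝ) : ℂ) * (propagatorCoeff f μ N (t + h) k - propagatorCoeff f μ N t k) -
        propagatorCoeff f μ (N + 1) t k = distCoeff f k * (μ k : ℂ) ^ N *
          ((h⁻¹ * (Real.exp (μ k * (t + h)) - Real.exp (μ k * t)) -
            μ k * Real.exp (μ k * t) : ℝ) : ℂ) := by
      simp only [propagatorCoeff]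
      push_cast
      ring
    rw [hfac, norm_mul, norm_mul, norm_pow, Complex.norm_real, Complex.norm_real,
      Real.norm_eq_abs, Real.norm_eq_abs]
    have h1 := abs_exp_difference_quotient_le (t := t) (t₁ := t₂) (hμ k) hh0 (by linarith)
    calc _ ≤ ‖distCoeff f k‖ * |μ k| ^ N * (|h| * (|μ k| ^ 2 * Real.exp (μ k * t₂))) := by
          gcongr
      _ = _ := by
          rw [pow_add]
          ring
  have hlim : Tendsto (fun h : ℝ => ENNReal.ofReal (|h| ^ 2 * B) * sobolevNormSq s f) (𝓝[≠] 0)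
      (𝓝 0) := by
    have h1 : Tendsto (fun h : ℝ => |h| ^ 2 * B) (𝓝[≠] 0) (𝓝 0) := by
      have : Continuous fun h : ℝ => |h| ^ 2 * B := by fun_prop
      simpa using (this.tendsto 0).mono_left nhdsWithin_le_nhds
    have h2 := ENNReal.Tendsto.mul_const (ENNReal.tendsto_ofReal h1)
      (b := sobolevNormSq s f) (Or.inr hf.ne)
    simpa using h2
  exact tendsto_of_tendsto_of_tendsto_of_le_of_le' tendsto_const_nhds hlim
    (Eventually.of_forall fun _ => zero_le) hbound

lemma IsPropagator.smoothInto (hr : ∀ i, 0 < r i) {s : ℝ} {f : PeriodicDistribution r}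
    (hf : MemSobolev s f) {μ : (Fin n → ℤ) → ℝ} (hμ : ∀ k, μ k ≤ 0)
    {D : ℕ → ℝ → PeriodicDistribution r} (hD : IsPropagator f μ D) {p : ℝ → ℝ}
    (hgain : ∀ t, 0 < t → SmoothingGain μ (p t - s) t) : SmoothInto p (D 0) := fun t ht =>
  ⟨D, (hgain t ht).eventually.mono fun _ hτ =>
    ⟨rfl, fun N => hD.hasGateauxDerivAt hr hf hμ hτ N⟩⟩

lemma IsPropagator.apply_zero (hr : ∀ i, 0 < r i) {f : PeriodicDistribution r}
    {μ : (Fin n → ℤ) → ℝ} {D : ℕ → ℝ → PeriodicDistribution r} (hD : IsPropagator f μ D) :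
    D 0 0 = f := by
  refine distribution_ext hr fun k => ?_
  rw [hD.distCoeff_eq hr 0 le_rfl, propagatorCoeff]
  simp

lemma IsPropagator.memSobolev_self (hr : ∀ i, 0 < r i) {s : ℝ} {f : PeriodicDistribution r}
    (hf : MemSobolev s f) {μ : (Fin n → ℤ) → ℝ} (hμ : ∀ k, μ k ≤ 0)
    {D : ℕ → ℝ → PeriodicDistribution r} (hD : IsPropagator f μ D) {t : ℝ} (ht : 0 ≤ t) :
    MemSobolev s (D 0 t) := by
  rcases ht.eq_or_lt with rfl | ht
  · rwa [hD.apply_zero hr]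
  · exact hD.memSobolev hr hf hμ (by rw [sub_self]; exact smoothingGain_zero hμ ht) 0

/-- Dominated convergence with the series of `‖f‖²` in `H^s` as majorant, valid because the
exponentials lie in `(0, 1]`. At `t₀ = 0` no smoothing is available, so the argument gives no rate.
-/
lemma IsPropagator.tendsto_sobolevNormSq_sub (hr : ∀ i, 0 < r i) {s : ℝ}
    {f : PeriodicDistribution r} (hf : MemSobolev s f) {μ : (Fin n → ℤ) → ℝ}
    (hμ : ∀ k, μ k ≤ 0) {D : ℕ → ℝ → PeriodicDistribution r} (hD : IsPropagator f μ D)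
    {t₀ : ℝ} (ht₀ : 0 ≤ t₀) :
    Tendsto (fun t => sobolevNormSq s (D 0 t - D 0 t₀)) (𝓝[Set.Ici 0] t₀) (𝓝 0) := by
  have hcoef : ∀ t, 0 ≤ t → ∀ k, ‖distCoeff (D 0 t - D 0 t₀) k‖ ^ 2 =
      ‖distCoeff f k‖ ^ 2 * (Real.exp (μ k * t) - Real.exp (μ k * t₀)) ^ 2 := by
    intro t ht k
    have h1 : distCoeff (D 0 t - D 0 t₀) k =
        distCoeff f k * ((Real.exp (μ k * t) - Real.exp (μ k * t₀) : ℝ) : ℂ) := by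
      rw [distCoeff_sub, hD.distCoeff_eq hr 0 ht, hD.distCoeff_eq hr 0 ht₀]
      simp only [propagatorCoeff]
      push_cast
      ring
    rw [h1, norm_mul, mul_pow, Complex.norm_real, Real.norm_eq_abs, sq_abs]
  let T : ℝ → (Fin n → ℤ) → ℝ := fun t k => latticeWeight k ^ s *
    (‖distCoeff f k‖ ^ 2 * (Real.exp (μ k * t) - Real.exp (μ k * t₀)) ^ 2)
  have hT0 : ∀ t k, 0 ≤ T t k := fun t k =>
    mul_nonneg (Real.rpow_nonneg (latticeWeight_pos k).le _) (by positivity)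
  have hTle : ∀ t, 0 ≤ t → ∀ k, T t k ≤ latticeWeight k ^ s * ‖distCoeff f k‖ ^ 2 := by
    intro t ht k
    have hexp : ∀ t, 0 ≤ t → Real.exp (μ k * t) ≤ 1 := fun t ht =>
      Real.exp_le_one_iff.2 (mul_nonpos_of_nonpos_of_nonneg (hμ k) ht)
    have h2 : (Real.exp (μ k * t) - Real.exp (μ k * t₀)) ^ 2 ≤ 1 := by
      rw [sq_le_one_iff_abs_le_one, abs_le]
      constructor <;>
      linarith [hexp t ht, hexp t₀ ht₀, Real.exp_pos (μ k * t), Real.exp_pos (μ k * t₀)]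
    refine mul_le_mul_of_nonneg_left ?_ (Real.rpow_nonneg (latticeWeight_pos k).le _)
    exact mul_le_of_le_one_right (sq_nonneg _) h2
  have hmem : ∀ᶠ t in 𝓝[Set.Ici 0] t₀, 0 ≤ t := self_mem_nhdsWithin
  have hlim : Tendsto (fun t => ∑' k, T t k) (𝓝[Set.Ici 0] t₀) (𝓝 (∑' _ : Fin n → ℤ, 0)) := by
    refine tendsto_tsum_of_dominated_convergence hf.summable (fun k => ?_) ?_
    · have : Continuous fun t => T t k := by fun_prop
      simpa [T] using (this.tendsto t₀).mono_left nhdsWithin_le_nhds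
    · filter_upwards [hmem] with t ht k
      rw [Real.norm_of_nonneg (hT0 t k)]
      exact hTle t ht k
  rw [tsum_zero] at hlim
  have h3 := ENNReal.tendsto_ofReal hlim
  rw [ENNReal.ofReal_zero] at h3
  refine h3.congr' ?_
  filter_upwards [hmem] with t ht
  rw [sobolevNormSq_eq, ENNReal.ofReal_tsum_of_nonneg (hT0 t)
    (Summable.of_nonneg_of_le (hT0 t) (hTle t ht) hf.summable)]
  exact tsum_congr fun k => by rw [hcoef t ht]

lemma IsPropagator.tendsto_apply (hr : ∀ i, 0 < r i) {s : ℝ} {f : PeriodicDistribution r}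
    (hf : MemSobolev s f) {μ : (Fin n → ℤ) → ℝ} (hμ : ∀ k, μ k ≤ 0)
    {D : ℕ → ℝ → PeriodicDistribution r} (hD : IsPropagator f μ D) (φ : PeriodicTest r) :
    Tendsto (fun t => (D 0 t).1 φ) (𝓝[>] 0) (𝓝 (f.1 φ)) := by
  obtain ⟨C, N, hC⟩ := hf.norm_distCoeff_le
  have hmem : ∀ᶠ t : ℝ in 𝓝[>] 0, 0 < t := self_mem_nhdsWithin
  have hlim : Tendsto (fun t => ∑' k, propagatorCoeff f μ 0 t k * testCoeff k φ) (𝓝[>] 0)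
      (𝓝 (∑' k, distCoeff f k * testCoeff k φ)) := by
    refine tendsto_tsum_of_dominated_convergence (summable_norm_mul_testCoeff hr hC φ)
      (fun k => ?_) ?_
    · have : Continuous fun t => propagatorCoeff f μ 0 t k * testCoeff k φ := by
        simp only [propagatorCoeff]
        fun_prop
      simpa [propagatorCoeff] using (this.tendsto 0).mono_left nhdsWithin_le_nhds
    · filter_upwards [hmem] with t ht k
      rw [norm_mul, norm_mul, norm_propagatorCoeff, pow_zero, one_mul]
      gcongr
      exact mul_le_of_le_one_right (norm_nonneg _) (Real.exp_le_one_iff.2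
        (mul_nonpos_of_nonpos_of_nonneg (hμ k) ht.le))
  have hf' : HasSum (fun k => distCoeff f k * testCoeff k φ) (f.1 φ) :=
    hasFourierSeries_distCoeff hr f φ
  rw [hf'.tsum_eq] at hlim
  refine hlim.congr' ?_
  filter_upwards [hmem] with t ht
  have h1 : HasSum (fun k => propagatorCoeff f μ 0 t k * testCoeff k φ) ((D 0 t).1 φ) :=
    hD 0 t ht.le φ
  exact h1.tsum_eq

lemma IsPropagator.isSolution (hr : ∀ i, 0 < r i) {δ β s q : ℝ} {f : PeriodicDistribution r}
    (hf : MemSobolev s f) (hμ : ∀ k, multiplier δ β (freq r k) ≤ 0)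
    {D : ℕ → ℝ → PeriodicDistribution r}
    (hD : IsPropagator f (fun k => multiplier δ β (freq r k)) D)
    (hgain : ∀ t, 0 < t → SmoothingGain (fun k => multiplier δ β (freq r k)) (q - s) t) :
    IsSolution δ β s q f (D 0) where
  mem _ ht := hD.memSobolev_self hr hf hμ ht
  initial := hD.apply_zero hr
  tendsto_initial := hD.tendsto_apply hr hf hμ
  equation t ht := by
    refine ⟨D 1 t, ?_, hD.hasGateauxDerivAt hr hf hμ (hgain t ht) 0⟩
    have h := hD 1 t ht.le
    have hc : propagatorCoeff f (fun k => multiplier δ β (freq r k)) 1 t =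
        fun k => (multiplier δ β (freq r k) : ℂ) * distCoeff (D 0 t) k := by
      ext k
      rw [hD.distCoeff_eq hr 0 ht.le]
      simp only [propagatorCoeff]
      ring
    rwa [hc] at h

/-! ### Uniqueness -/

/-- With the integrating factor `e^{-mt}` the function becomes constant on `(0, ∞)`; the constant is
read off from the right limit at `0`. -/
lemma eq_mul_exp_of_hasDerivAt {u : ℝ → ℂ} {m : ℝ} {a : ℂ}
    (hu : ∀ t, 0 < t → HasDerivAt u (m * u t) t) (h0 : Tendsto u (𝓝[>] 0) (𝓝 a)) {t : ℝ}
    (ht : 0 < t) : u t = a * Complex.exp ((m * t : ℝ) : ℂ) := by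
  let v : ℝ → ℂ := fun t => u t * Complex.exp ((-(m * t) : ℝ) : ℂ)
  have hexp : ∀ t : ℝ, HasDerivAt (fun t : ℝ => Complex.exp ((-(m * t) : ℝ) : ℂ))
      (Complex.exp ((-(m * t) : ℝ) : ℂ) * ((-m : ℝ) : ℂ)) t := by
    intro t
    have h1 : HasDerivAt (fun t : ℝ => -(m * t)) (-m) t := by
      simpa using ((hasDerivAt_id t).const_mul m).fun_neg
    exact h1.ofReal_comp.cexp
  have hv : ∀ t ∈ Set.Ioi (0 : ℝ), HasDerivAt v 0 t := by
    intro t ht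
    have h2 := (hu t ht).mul (hexp t)
    refine h2.congr_deriv ?_
    push_cast
    ring
  have hconst : ∀ t' ∈ Set.Ioi (0 : ℝ), v t' = v t := fun t' ht' =>
    isOpen_Ioi.is_const_of_deriv_eq_zero isPreconnected_Ioi
      (fun x hx => (hv x hx).differentiableAt.differentiableWithinAt)
      (fun x hx => (hv x hx).deriv) ht' ht
  have hlim1 : Tendsto v (𝓝[>] 0) (𝓝 (v t)) :=
    tendsto_const_nhds.congr' (eventually_nhdsWithin_of_forall fun t' ht' => (hconst t' ht').symm)
  have hlim2 : Tendsto v (𝓝[>] 0) (𝓝 a) := by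
    have h3 := h0.mul ((hexp 0).continuousAt.tendsto.mono_left
      (nhdsWithin_le_nhds (s := Set.Ioi 0)))
    simpa [v] using h3
  have hva : v t = a := tendsto_nhds_unique hlim1 hlim2
  rw [← hva]
  simp only [v]
  rw [mul_assoc, ← Complex.exp_add]
  simp

lemma IsSolution.distCoeff_eq (hr : ∀ i, 0 < r i) {δ β s q : ℝ} {f : PeriodicDistribution r}
    {U : ℝ → PeriodicDistribution r} (hU : IsSolution δ β s q f U) {t : ℝ} (ht : 0 < t)
    (k : Fin n → ℤ) :
    distCoeff (U t) k = propagatorCoeff f (fun k => multiplier δ β (freq r k)) 0 t k := by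
  rw [propagatorCoeff, pow_zero, mul_one]
  refine eq_mul_exp_of_hasDerivAt (u := fun t => distCoeff (U t) k) (fun t ht => ?_) ?_ ht
  · obtain ⟨V, hV, -, -, hlim⟩ := hU.equation t ht
    have h1 := tendsto_distCoeff_of_sobolevNormSq hlim k
    simp only [distCoeff_sub, distCoeff_smul, distCoeff_eq_of_hasFourierSeries hr hV] at h1
    rw [hasDerivAt_iff_tendsto_slope_zero]
    have h2 := h1.add_const ((multiplier δ β (freq r k) : ℂ) * distCoeff (U t) k)
    simp only [sub_add_cancel, zero_add] at h2
    exact h2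
  -- A Fourier coefficient is a multiple of a pairing with a character, so the distributional
  -- initial condition suffices.
  · exact (hU.tendsto_initial (character r (-k))).const_mul _

lemma IsSolution.eqOn_propagator (hr : ∀ i, 0 < r i) {δ β s q : ℝ} {f : PeriodicDistribution r}
    {U : ℝ → PeriodicDistribution r} (hU : IsSolution δ β s q f U)
    {D : ℕ → ℝ → PeriodicDistribution r}
    (hD : IsPropagator f (fun k => multiplier δ β (freq r k)) D) :
    Set.EqOn U (D 0) (Set.Ici 0) := by
  intro t ht
  rcases (Set.mem_Ici.1 ht).eq_or_lt with rfl | ht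
  · rw [hU.initial, hD.apply_zero hr]
  · exact distribution_ext hr fun k => by rw [hU.distCoeff_eq hr ht, hD.distCoeff_eq hr 0 ht.le]

/-! ### The multipliers on the dual lattice -/

lemma sum_sq_le_mul_norm_freq_sq (hr : ∀ i, 0 < r i) :
    ∃ B, 0 < B ∧ ∀ k : Fin n → ℤ, ∑ i, (k i : ℝ) ^ 2 ≤ B * ‖freq r k‖ ^ 2 := by
  have hnn : 0 ≤ ∑ i, (r i / (2 * Real.pi)) ^ 2 := Finset.sum_nonneg fun _ _ => sq_nonneg _
  refine ⟨1 + ∑ i, (r i / (2 * Real.pi)) ^ 2, by linarith, fun k => ?_⟩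
  rw [EuclideanSpace.norm_sq_eq, Finset.mul_sum]
  refine Finset.sum_le_sum fun i _ => ?_
  have h1 : (k i : ℝ) = r i / (2 * Real.pi) * freq r k i := by
    have h2 : freq r k i = 2 * Real.pi * (k i : ℝ) / r i := rfl
    have := (hr i).ne'
    have := Real.pi_ne_zero
    rw [h2]
    field_simp
  rw [h1, mul_pow, Real.norm_eq_abs, sq_abs]
  gcongr
  refine (Finset.single_le_sum (f := fun i => (r i / (2 * Real.pi)) ^ 2)
    (fun _ _ => sq_nonneg _) (Finset.mem_univ i)).trans (by simp)

/-- Away from `k = 0` the weight is at most a constant times `‖ν_k‖²`; the square accounts for the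
factor `2`. At `k = 0` both logarithms are `0`, one by the convention `Real.log 0 = 0`. -/
lemma multiplier_freq_le_of_log (hr : ∀ i, 0 < r i) {δ β C σ : ℝ} (hσ : 0 ≤ σ)
    (h : ∀ ν : EuclideanSpace ℝ (Fin n), multiplier δ β ν ≤ C - 2 * σ * Real.log ‖ν‖) :
    ∃ C', ∀ k, multiplier δ β (freq r k) ≤ C' - σ * Real.log (latticeWeight k) := by
  obtain ⟨B, hB, hBk⟩ := sum_sq_le_mul_norm_freq_sq hr
  refine ⟨C + σ * |Real.log (2 * B)|, fun k => ?_⟩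
  rcases eq_or_ne k 0 with rfl | hk
  · have h0 : freq r 0 = 0 := by ext i; simp [freq]
    have h1 := h (freq r 0)
    have h2 : 0 ≤ σ * |Real.log (2 * B)| := by positivity
    simp only [h0, norm_zero, Real.log_zero, mul_zero, sub_zero] at h1
    simp only [h0, latticeWeight]
    simp
    linarith
  · have hone : 1 ≤ ∑ i, (k i : ℝ) ^ 2 := by
      obtain ⟨i, hi⟩ := Function.ne_iff.1 hk
      have hi : k i ≠ 0 := hi
      have h1 : (1 : ℝ) ≤ (k i : ℝ) ^ 2 := by
        have : 1 ≤ k i ^ 2 := Int.add_one_le_iff.2 (sq_pos_of_ne_zero hi)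
        exact_mod_cast this
      exact h1.trans (Finset.single_le_sum (f := fun i => (k i : ℝ) ^ 2)
        (fun _ _ => sq_nonneg _) (Finset.mem_univ i))
    have h2 : latticeWeight k ≤ 2 * B * ‖freq r k‖ ^ 2 := by
      rw [latticeWeight]
      linarith [hBk k]
    have hν : 0 < ‖freq r k‖ := by
      refine (norm_nonneg _).lt_of_ne fun h0 => ?_
      have := hBk k
      rw [← h0] at this
      norm_num at this
      linarith
    have h3 := Real.log_le_log (latticeWeight_pos k) h2
    rw [Real.log_mul (by positivity) (by positivity), Real.log_pow] at h3
    have h4 := mul_le_mul_of_nonneg_left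
      (h3.trans (add_le_add_left (le_abs_self (Real.log (2 * B))) _)) hσ
    have h5 := h (freq r k)
    push_cast at h4
    linarith

lemma abs_multiplier_freq_le (hn : 1 ≤ n) (r : Fin n → ℝ) {δ β : ℝ} (hδ : 0 < δ)
    (hβ : β < n + 4) :
    ∃ B, ∀ k, |multiplier δ β (freq r k)| ≤ B * latticeWeight k ^ 4 := by
  obtain ⟨C, hC0, hC⟩ := abs_multiplier_le (n := n) hn hδ hβ
  obtain ⟨B, hB1, hB⟩ := norm_freq_le r
  refine ⟨C * (2 * B) ^ 4, fun k => (hC _).trans ?_⟩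
  have hw := one_le_latticeWeight k
  have h1 : 1 + ‖freq r k‖ ≤ 2 * B * latticeWeight k := by nlinarith [hB k]
  rw [mul_assoc, ← mul_pow]
  gcongr

lemma smoothingGain_multiplier_natCast (hn : 1 ≤ n) (hr : ∀ i, 0 < r i) {δ : ℝ} (hδ : 0 < δ)
    {ε : ℝ} (hε : 0 < ε) (hε1 : ε < 1) {t : ℝ} (ht : 0 < t) :
    SmoothingGain (fun k => multiplier δ n (freq r k)) (4 * n * t / δ ^ 2 * (1 - ε)) t := by
  have hn0 : (0 : ℝ) < n := by exact_mod_cast hn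
  have hε2 : 0 < 1 - ε / 2 := by linarith
  -- The loss `ε` is split evenly between the logarithmic rate and the time `t₁ = t (1 - ε/2)`,
  -- using `(1 - ε/2)² ≥ 1 - ε`.
  have hσ : 0 < 2 * n / δ ^ 2 * (1 - ε / 2) := by positivity
  have hlt : 2 * (2 * n / δ ^ 2 * (1 - ε / 2)) < 4 * n / δ ^ 2 := by
    have h1 : 0 < 4 * n / δ ^ 2 := by positivity
    have h2 : 2 * (2 * n / δ ^ 2 * (1 - ε / 2)) = 4 * n / δ ^ 2 * (1 - ε / 2) := by ring
    rw [h2]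
    exact mul_lt_of_lt_one_right h1 (by linarith)
  obtain ⟨C, hC⟩ := multiplier_natCast_le hn hδ (by positivity) hlt
  obtain ⟨C', hC'⟩ := multiplier_freq_le_of_log hr hσ.le hC
  refine smoothingGain_of_log hC' (t₁ := t * (1 - ε / 2)) (by positivity)
    (mul_lt_of_lt_one_right ht (by linarith)) ?_
  have h3 : 2 * (2 * n / δ ^ 2 * (1 - ε / 2)) * (t * (1 - ε / 2)) =
      4 * n * t / δ ^ 2 * (1 - ε / 2) ^ 2 := by ring
  rw [h3]
  refine mul_le_mul_of_nonneg_left ?_ (by positivity)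
  nlinarith [sq_nonneg ε]

lemma smoothingGain_multiplier_of_lt (hn : 1 ≤ n) (hr : ∀ i, 0 < r i) {δ β : ℝ} (hδ : 0 < δ)
    (hβn : n < β) (hβ : β < n + 4) (p : ℝ) {t : ℝ} (ht : 0 < t) :
    SmoothingGain (fun k => multiplier δ β (freq r k)) p t := by
  -- Any rate is available, so this one is chosen to gain order `|p|` already at time `t/2`.
  have hσ : 0 ≤ |p| / t := by positivity
  obtain ⟨C, hC⟩ := multiplier_le_sub_log hn hδ hβn hβ (mul_nonneg zero_le_two hσ)
  obtain ⟨C', hC'⟩ := multiplier_freq_le_of_log hr hσ hC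
  refine smoothingGain_of_log hC' (half_pos ht) (half_lt_self ht) ?_
  have h1 : 2 * (|p| / t) * (t / 2) = |p| := by field_simp
  rw [h1]
  exact le_abs_self p

end NonlocalDiffusion

end

open NonlocalDiffusion
theorem mainTheorem2 {n : ℕ} (hn : 1 ≤ n) (r : Fin n → ℝ) (hr : ∀ i, 0 < r i)
    (δ : ℝ) (hδ : 0 < δ) (β : ℝ) (hβ : β < n + 4) (s : ℝ)
    (f : PeriodicDistribution r) (hf : MemSobolev s f) :
    ∃ U : ℝ → PeriodicDistribution r,
      -- existence, with `q = s` if `β ≤ n` and `q` arbitrary if `β > n`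
      (∀ q : ℝ, (β ≤ n → q = s) → IsSolution δ β s q f U) ∧
      -- continuity on `[0,∞)` with values in `H^s`
      (∀ t₀ : ℝ, 0 ≤ t₀ →
        Tendsto (fun t => sobolevNormSq s (U t - U t₀)) (𝓝[Set.Ici 0] t₀) (𝓝 0)) ∧
      -- uniqueness
      (∀ (q : ℝ) (U' : ℝ → PeriodicDistribution r),
        IsSolution δ β s q f U' → Set.EqOn U' U (Set.Ici 0)) ∧
      -- termwise formula for the solution and all of its time derivatives
      (∃ D : ℕ → ℝ → PeriodicDistribution r, D 0 = U ∧
        (∀ (N : ℕ) (t : ℝ), 0 ≤ t → HasFourierSeries (fun k => distCoeff f k *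
          (multiplier δ β (freq r k) : ℂ) ^ N *
            Complex.exp (((multiplier δ β (freq r k) * t : ℝ)) : ℂ)) (D N t)) ∧
        (∀ q : ℝ, (β ≤ n → q = s) → ∀ (N : ℕ) (t : ℝ), 0 < t →
          HasGateauxDerivAt q (D N) (D (N + 1) t) t)) ∧
      -- smoothness in time with values in `H^p`
      (β < n → SmoothInto (fun _ => s) U) ∧
      (β = n → ∀ ε : ℝ, 0 < ε → ε < 1 →
        SmoothInto (fun t => s + 4 * n * t / δ ^ 2 * (1 - ε)) U) ∧
      (n < β → ∀ q : ℝ, SmoothInto (fun _ => q) U) := by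
  have hμ : ∀ k, multiplier δ β (freq r k) ≤ 0 := fun k => multiplier_nonpos hn hδ hβ _
  obtain ⟨B, hB⟩ := abs_multiplier_freq_le hn r hδ hβ
  obtain ⟨D, hD⟩ := exists_isPropagator hr hf hμ hB
  -- Admissibility of `q` enters only here: no gain is required if `β ≤ n`, and any gain is
  -- available if `β > n`.
  have hgain : ∀ q : ℝ, (β ≤ n → q = s) → ∀ t, 0 < t →
      SmoothingGain (fun k => multiplier δ β (freq r k)) (q - s) t := by
    intro q hq t ht
    rcases le_or_gt β n with h | h
    · rw [hq h, sub_self]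
      exact smoothingGain_zero hμ ht
    · exact smoothingGain_multiplier_of_lt hn hr hδ h hβ _ ht
  refine ⟨D 0, fun q hq => hD.isSolution hr hf hμ (hgain q hq),
    fun t₀ ht₀ => hD.tendsto_sobolevNormSq_sub hr hf hμ ht₀,
    fun q U' hU' => hU'.eqOn_propagator hr hD,
    ⟨D, rfl, hD, fun q hq N t ht => hD.hasGateauxDerivAt hr hf hμ (hgain q hq t ht) N⟩,
    fun _ => hD.smoothInto hr hf hμ (hgain s fun _ => rfl), ?_,
    fun h q => hD.smoothInto hr hf hμ (hgain q fun h' => absurd h (not_lt.2 h'))⟩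
  rintro rfl ε hε hε1
  refine hD.smoothInto hr hf hμ fun t ht => ?_
  rw [add_sub_cancel_left]
  exact smoothingGain_multiplier_natCast hn hr hδ hε hε1 ht
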